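/- **Theorem (Pizzetti formula on the Stiefel manifold).** Let $m>4$ be an integer and let $\mathcal{P}(\mathbb{R}^{2m},\mathbb{C})$ be the space of complex polynomials $P(x,u)$ in two vector variables $x,u\in\mathbb{R}^m$. Let $V_2(\mathbb{R}^m)=\{(\omega,\eta)\in S^{m-1}\times S^{m-1}:\langle\omega,\eta\rangle=0\}\cong \mathrm{SO}(m)/\mathrm{SO}(m-2)$ be the Stiefel manifold and let $dS_2$ be its $\mathrm{SO}(m)$-invariant measure, normalised to total mass $1$, i.e. the image of the Haar probability measure of $\mathrm{SO}(m)$ under $g\mapsto(ge_1,ge_2)$. Write $\Delta_x=\sum_j\partial_{x_j}^2$, $\Delta_u=\sum_j\partial_{u_j}^2$, $\mathbb{E}_x=\sum_j x_j\partial_{x_j}$, $\mathbb{E}_u=\sum_j u_j\partial_{u_j}$, $\langle\partial_u,\partial_x\rangle=\sum_j\partial_{u_j}\partial_{x_j}$, $H_x=-(\mathbb{E}_x+\frac m2)$, $H_u=-(\mathbb{E}_u+\frac m2)$ and $a^{(n)}=a(a+1)\cdots(a+n-1)$; a function of $\mathbb{E}_x$ (of $\mathbb{E}_u$) acts on polynomials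 homogeneous of degree $p$ in $x$ (in $u$) as multiplication by its value at $p$. Put $$\pi_x=\sum_{s=0}^\infty\frac{1}{4^s s!}\,\frac{1}{(H_x+2)^{(s)}}\,|x|^{2s}\Delta_x^s,\qquad \pi_u=\sum_{s=0}^\infty\frac{1}{4^s s!}\,\frac{1}{(H_u+2)^{(s)}}\,|u|^{2s}\Delta_u^s,\qquad \pi_{\mathfrak s}=\pi_x\pi_u,\qquad A=\pi_{\mathfrak s}\langle\partial_u,\partial_x\rangle,$$ (the sums are finite on every polynomial; the factor that depends on $H_x$ or $H_u$ is applied last) and, for $j,k\in\mathbb{N}$, $$\pi_{j,k}=\frac{1}{4^{j+k}j!\,k!}\,\frac{\Gamma(\mathbb{E}_x+\frac m2)}{\Gamma(\mathbb{E}_x+\frac m2+j)}\,\frac{\Gamma(\mathbb{E}_u+\frac m2)}{\Gamma(\mathbb{E}_u+\frac m2+k)}\,\pi_{\mathfrak s}\,\Delta_x^j\Delta_u^k .$$ Then every $P\in\mathcal{P}(\mathbb{R}^{2m},\mathbb{C})$ is integrable over $V_2(\mathbb{R}^m)$, only finitely many terms of the following sum are non-zero, and $$\int_{V_2(\mathbb{R}^m)}P(\omega,\eta)\,dS_2=\sum_{i,j,k\in\mathbb{N}}\gamma_i\,\bigl(A^{2i}\pi_{j,k}P\bigr)(0,0),\qquad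 \gamma_i=\frac{(-1)^i}{4^{2i}\,i!\,\left(\frac m2\right)^{(2i)}\left(\frac{m-1}{2}\right)^{(i)}} .$$ -/

import Mathlib

noncomputable section

namespace StiefelPizzetti

open MeasureTheory MvPolynomial

/-! ## Polynomials in two vector variables and the basic operators -/

/-- The space `𝒫(ℝ^{2m}, ℂ)` of complex polynomials in two vector variables `(x, u)`; the variable
`Sum.inl i` is `x_i` and the variable `Sum.inr i` is `u_i`. -/
abbrev Poly (m : ℕ) : Type := MvPolynomial (Fin m ⊕ Fin m) ℂ

variable {m : ℕ}

/-- The degree of a monomial in the variables `x`. -/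
def degX (s : (Fin m ⊕ Fin m) →₀ ℕ) : ℕ := ∑ i, s (Sum.inl i)

/-- The degree of a monomial in the variables `u`. -/
def degU (s : (Fin m ⊕ Fin m) →₀ ℕ) : ℕ := ∑ i, s (Sum.inr i)

/-- The partial derivative `∂_{x_i}` as a linear operator. -/
def dX (i : Fin m) : Module.End ℂ (Poly m) := (pderiv (Sum.inl i) : Derivation ℂ _ _).toLinearMap

/-- The partial derivative `∂_{u_i}` as a linear operator. -/
def dU (i : Fin m) : Module.End ℂ (Poly m) := (pderiv (Sum.inr i) : Derivation ℂ _ _).toLinearMap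

/-- Multiplication by `x_i`. -/
def mX (i : Fin m) : Module.End ℂ (Poly m) := LinearMap.mulLeft ℂ (X (Sum.inl i))

/-- Multiplication by `u_i`. -/
def mU (i : Fin m) : Module.End ℂ (Poly m) := LinearMap.mulLeft ℂ (X (Sum.inr i))

/-- The Laplace operator `Δ_x`. -/
def lapX : Module.End ℂ (Poly m) := ∑ i, dX i ^ 2

/-- The Laplace operator `Δ_u`. -/
def lapU : Module.End ℂ (Poly m) := ∑ i, dU i ^ 2

/-- Multiplication by `|x|²`. -/
def sqX : Module.End ℂ (Poly m) := ∑ i, mX i ^ 2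

/-- Multiplication by `|u|²`. -/
def sqU : Module.End ℂ (Poly m) := ∑ i, mU i ^ 2

/-- The operator `⟨∂_u, ∂_x⟩ = ∑ ∂_{u_i} ∂_{x_i}`. -/
def dUdX : Module.End ℂ (Poly m) := ∑ i, dU i * dX i

/-- The Euler operator `𝔼_x = ∑ x_i ∂_{x_i}`. -/
def eulerX : Module.End ℂ (Poly m) := ∑ i, mX i * dX i

/-- The Euler operator `𝔼_u = ∑ u_i ∂_{u_i}`. -/
def eulerU : Module.End ℂ (Poly m) := ∑ i, mU i * dU i

/-- The operator `f(𝔼_x)`: it multiplies a polynomial that is homogeneous of degree `p` in `x`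
by the scalar `f p`. -/
def funEulerX (f : ℕ → ℂ) : Module.End ℂ (Poly m) :=
  (basisMonomials (Fin m ⊕ Fin m) ℂ).constr ℂ fun s => f (degX s) • monomial s 1

/-- The operator `f(𝔼_u)`: it multiplies a polynomial that is homogeneous of degree `q` in `u`
by the scalar `f q`. -/
def funEulerU (f : ℕ → ℂ) : Module.End ℂ (Poly m) :=
  (basisMonomials (Fin m ⊕ Fin m) ℂ).constr ℂ fun s => f (degU s) • monomial s 1

/-- `funEulerX` is the functional calculus of the Euler operator: the identity function
gives back `𝔼_x`. -/
theorem funEulerX_id : funEulerX (fun p => (p : ℂ)) = (eulerX : Module.End ℂ (Poly m)) := by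
  refine (basisMonomials (Fin m ⊕ Fin m) ℂ).ext fun s => ?_
  rw [funEulerX, Module.Basis.constr_basis]
  simp only [eulerX, mX, dX, coe_basisMonomials, LinearMap.sum_apply, Module.End.mul_apply,
    LinearMap.mulLeft_apply, Derivation.coeFn_coe, X_mul_pderiv_monomial, degX]
  rw [← Finset.sum_smul, Nat.cast_sum]
  simp only [← Nat.cast_sum, Nat.cast_smul_eq_nsmul]

/-- `funEulerU` is the functional calculus of the Euler operator: the identity function
gives back `𝔼_u`. -/
theorem funEulerU_id : funEulerU (fun p => (p : ℂ)) = (eulerU : Module.End ℂ (Poly m)) := by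
  refine (basisMonomials (Fin m ⊕ Fin m) ℂ).ext fun s => ?_
  rw [funEulerU, Module.Basis.constr_basis]
  simp only [eulerU, mU, dU, coe_basisMonomials, LinearMap.sum_apply, Module.End.mul_apply,
    LinearMap.mulLeft_apply, Derivation.coeFn_coe, X_mul_pderiv_monomial, degU]
  rw [← Finset.sum_smul, Nat.cast_sum]
  simp only [← Nat.cast_sum, Nat.cast_smul_eq_nsmul]

/-! ## The extremal projection operators -/

/-- The rising factorial `a (a + 1) ⋯ (a + n - 1)`. -/
def rising (a : ℂ) (n : ℕ) : ℂ := ∏ k ∈ Finset.range n, (a + k)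

/-- The `j`-th term `(4^j j!)⁻¹ Γ(H_x + 2) / Γ(H_x + 2 + j) |x|^{2j} Δ_x^j` of the extremal projection
operator in `x`, where `H_x = -(𝔼_x + m / 2)` and where
`Γ(H_x + 2) / Γ(H_x + 2 + j) = ((H_x + 2) (H_x + 3) ⋯ (H_x + j + 1))⁻¹`. -/
def extremalTermX (j : ℕ) : Module.End ℂ (Poly m) :=
  ((4 : ℂ) ^ j * (j.factorial : ℂ))⁻¹ •
    (funEulerX (fun p => (rising (-((p : ℂ) + (m : ℂ) / 2) + 2) j)⁻¹) * sqX ^ j * lapX ^ j)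

/-- The `j`-th term `(4^j j!)⁻¹ Γ(H_u + 2) / Γ(H_u + 2 + j) |u|^{2j} Δ_u^j` of the extremal projection
operator in `u`, where `H_u = -(𝔼_u + m / 2)`. -/
def extremalTermU (j : ℕ) : Module.End ℂ (Poly m) :=
  ((4 : ℂ) ^ j * (j.factorial : ℂ))⁻¹ •
    (funEulerU (fun q => (rising (-((q : ℂ) + (m : ℂ) / 2) + 2) j)⁻¹) * sqU ^ j * lapU ^ j)

/-- The extremal projection operator `π_x = ∑_{j ≥ 0} extremalTermX j`. On a monomial the sum is
finite, because `Δ_x^j` annihilates every monomial of degree smaller than `2 j` in `x`. -/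
def piX : Module.End ℂ (Poly m) :=
  (basisMonomials (Fin m ⊕ Fin m) ℂ).constr ℂ fun s =>
    ∑ j ∈ Finset.range (degX s + 1), extremalTermX j (monomial s 1)

/-- The extremal projection operator `π_u = ∑_{j ≥ 0} extremalTermU j`. On a monomial the sum is
finite, because `Δ_u^j` annihilates every monomial of degree smaller than `2 j` in `u`. -/
def piU : Module.End ℂ (Poly m) :=
  (basisMonomials (Fin m ⊕ Fin m) ℂ).constr ℂ fun s =>
    ∑ j ∈ Finset.range (degU s + 1), extremalTermU j (monomial s 1)

/-- The extremal projection operator `π_𝔰 = π_x π_u` onto the double harmonic polynomials. -/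
def piS : Module.End ℂ (Poly m) := piX * piU

/-- The annihilation operator `A = π_𝔰 ⟨∂_u, ∂_x⟩`. -/
def opA : Module.End ℂ (Poly m) := piS * dUdX

/-- The projection operator `π_{j,k}`, which maps polynomials that are homogeneous of degree `(p, q)`
in `(x, u)` to double harmonic polynomials that are homogeneous of degree `(p - 2j, q - 2k)`:
`(4^{j+k} j! k!)⁻¹ Γ(𝔼_x + m/2) / Γ(𝔼_x + m/2 + j) Γ(𝔼_u + m/2) / Γ(𝔼_u + m/2 + k) π_𝔰 Δ_x^j Δ_u^k`. -/
def projJK (j k : ℕ) : Module.End ℂ (Poly m) :=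
  ((4 : ℂ) ^ (j + k) * (j.factorial : ℂ) * (k.factorial : ℂ))⁻¹ •
    (funEulerX (fun p => Complex.Gamma ((p : ℂ) + (m : ℂ) / 2) /
        Complex.Gamma ((p : ℂ) + (m : ℂ) / 2 + j)) *
      funEulerU (fun q => Complex.Gamma ((q : ℂ) + (m : ℂ) / 2) /
        Complex.Gamma ((q : ℂ) + (m : ℂ) / 2 + k)) *
      piS * lapX ^ j * lapU ^ k)

/-- The constant `γ_i = (-1)^i / (4^{2i} i! (m/2)^{(2i)} ((m-1)/2)^{(i)})`, with rising factorials
in the denominator. -/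
def gammaCoeff (m i : ℕ) : ℂ :=
  (-1) ^ i / ((4 : ℂ) ^ (2 * i) * (i.factorial : ℂ) *
    rising ((m : ℂ) / 2) (2 * i) * rising (((m : ℂ) - 1) / 2) i)

/-! ## The Stiefel manifold and its invariant measure -/

/-- The Stiefel manifold `V_2(ℝ^m)` of pairs `(ω, η)` of orthonormal vectors in `ℝ^m`. -/
def stiefel (m : ℕ) : Set (EuclideanSpace ℝ (Fin m) × EuclideanSpace ℝ (Fin m)) :=
  {p | ‖p.1‖ = 1 ∧ ‖p.2‖ = 1 ∧ inner ℝ p.1 p.2 = 0}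

/-- The group `SO(m)`. -/
abbrev SO (m : ℕ) : Type := Matrix.specialOrthogonalGroup (Fin m) ℝ

instance : MeasurableSpace (SO m) := borel _

instance : BorelSpace (SO m) := ⟨rfl⟩

instance : IsTopologicalGroup (SO m) where
  continuous_inv := by
    refine Continuous.subtype_mk (f := fun g : SO m => (g : Matrix (Fin m) (Fin m) ℝ).transpose) ?_ _
    exact continuous_subtype_val.matrix_transpose

theorem SO.mul_transpose (g : SO m) :
    (g : Matrix (Fin m) (Fin m) ℝ) * (g : Matrix (Fin m) (Fin m) ℝ).transpose = 1 :=
  (Matrix.mem_orthogonalGroup_iff _ _).1 g.2.1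

theorem SO.transpose_mul (g : SO m) :
    (g : Matrix (Fin m) (Fin m) ℝ).transpose * (g : Matrix (Fin m) (Fin m) ℝ) = 1 :=
  (Matrix.mem_orthogonalGroup_iff' _ _).1 g.2.1

instance : CompactSpace (SO m) := by
  refine isCompact_iff_compactSpace.1 ?_
  have hK : IsCompact (Set.pi Set.univ fun _ : Fin m => Set.pi Set.univ fun _ : Fin m =>
      Set.Icc (-1 : ℝ) 1) :=
    isCompact_univ_pi fun _ => isCompact_univ_pi fun _ => isCompact_Icc
  have hset : (Matrix.specialOrthogonalGroup (Fin m) ℝ : Set (Matrix (Fin m) (Fin m) ℝ)) =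
      {A | A * A.transpose = 1 ∧ A.det = 1} := by
    ext A
    exact Matrix.mem_specialOrthogonalGroup_iff.trans
      (and_congr_left' (Matrix.mem_orthogonalGroup_iff _ _))
  refine IsCompact.of_isClosed_subset (s := (Set.pi Set.univ fun _ : Fin m =>
      Set.pi Set.univ fun _ : Fin m => Set.Icc (-1 : ℝ) 1 : Set (Matrix (Fin m) (Fin m) ℝ)))
    hK ?_ ?_
  · rw [hset]
    exact (isClosed_eq (continuous_id.matrix_mul continuous_id.matrix_transpose)
      continuous_const).inter (isClosed_eq continuous_id.matrix_det continuous_const)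
  · intro (A : Matrix (Fin m) (Fin m) ℝ) hA
    rw [hset] at hA
    intro i _ j _
    have h1 : ∑ k, A i k * A i k = 1 := by
      have := congrFun (congrFun hA.1 i) i
      rwa [Matrix.mul_apply, Matrix.one_apply_eq] at this
    have h2 : A i j * A i j ≤ 1 := h1 ▸
      Finset.single_le_sum (f := fun k => A i k * A i k) (fun k _ => mul_self_nonneg _)
        (Finset.mem_univ j)
    exact abs_le.1 (abs_le_one_iff_mul_self_le_one.2 h2)

/-- The point of the Stiefel manifold (for `m > 4`) given by the first two columns `(g e_1, g e_2)`
of `g ∈ SO(m)`; this is the projection `SO(m) → SO(m) / SO(m - 2) ≅ V_2(ℝ^m)`. -/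
def toStiefel (hm : 4 < m) (g : SO m) : stiefel m :=
  ⟨(WithLp.toLp 2 fun i => (g : Matrix (Fin m) (Fin m) ℝ) i ⟨0, by omega⟩,
    WithLp.toLp 2 fun i => (g : Matrix (Fin m) (Fin m) ℝ) i ⟨1, by omega⟩), by
    have h (a b : Fin m) : ∑ i, (g : Matrix (Fin m) (Fin m) ℝ) i a *
        (g : Matrix (Fin m) (Fin m) ℝ) i b = (1 : Matrix (Fin m) (Fin m) ℝ) a b := by
      have := congrFun (congrFun (SO.transpose_mul g) a) b
      simpa [Matrix.mul_apply] using this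
    refine ⟨?_, ?_, ?_⟩
    · simp [EuclideanSpace.norm_eq, pow_two, h]
    · simp [EuclideanSpace.norm_eq, pow_two, h]
    · simp only [PiLp.inner_apply, RCLike.inner_apply, conj_trivial]
      simp [h]⟩

theorem continuous_toStiefel (hm : 4 < m) : Continuous (toStiefel hm) := by
  refine Continuous.subtype_mk (Continuous.prodMk ?_ ?_) _ <;>
  · refine (PiLp.continuous_toLp 2 _).comp (continuous_pi fun i => ?_)
    exact continuous_subtype_val.matrix_elem _ _

/-- The Haar probability measure on the compact group `SO(m)`. -/
def haarSO (m : ℕ) : Measure (SO m) := Measure.haarMeasure ⊤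

/-- The invariant measure `dS_2` on the Stiefel manifold `V_2(ℝ^m)`, of total mass one: the image of
the Haar probability measure under the projection `SO(m) → V_2(ℝ^m)`. -/
def stiefelMeasure (hm : 4 < m) : Measure (stiefel m) := (haarSO m).map (toStiefel hm)

instance : IsProbabilityMeasure (haarSO m) := ⟨by
  simpa [haarSO] using Measure.haarMeasure_self (G := SO m) (K₀ := ⊤)⟩

instance (hm : 4 < m) : IsProbabilityMeasure (stiefelMeasure hm) :=
  Measure.isProbabilityMeasure_map (continuous_toStiefel hm).measurable.aemeasurable

/-- The value `P(x, u)` of the polynomial `P` at a pair of real vectors. -/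
def evalAt (P : Poly m) (x u : EuclideanSpace ℝ (Fin m)) : ℂ :=
  eval (Sum.elim (fun i => (x i : ℂ)) fun i => (u i : ℂ)) P

end StiefelPizzetti

end

noncomputable section

namespace StiefelPizzetti

open MeasureTheory MvPolynomial

variable {m : ℕ}

/-! ## Elementary commutation relations -/

/-! Both sides of the formula are linear functionals `M` on polynomials, and each has five
properties: `M(|x|²P) = M(P)`, `M(|u|²P) = M(P)`, `M(⟨x,u⟩P) = 0`, `M` annihilates the image of
every infinitesimal rotation `opRot a b`, and `M(1) = 1`. These properties determine `M`, by
`eq_zero_of_invariant` applied to the difference.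

Uniqueness: summing the rotations against coordinates and derivatives gives Casimir-type identities
that express a non-zero multiple of `M(P)` through values of `M` at polynomials of smaller degree in
`x`, or in `u` once `P` does not depend on `x`. Induction reduces everything to constants.

The integral: the three equations hold because the first two columns of an element of `SO(m)` are
orthonormal. Invariance follows by differentiating the constant function `t ↦ ∫ P(R(t)g) dg` at `0`,
where `R(t)` rotates a coordinate plane.

The series: by the Fischer decomposition every polynomial is a sum of terms `|x|^{2a}|u|^{2b}H` with
`H` double harmonic. On such a term `π_{j,k}` returns `H` if `(j,k) = (a,b)` and `0` otherwise, and
`A` acts on double harmonics as `D = ⟨∂_u,∂_x⟩`. The series therefore has the value `∑ γ_i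
(D^{2i}H)(0)`, which does not depend on `a, b`; this settles the first two equations. Rotations
commute with all operators involved and vanish at the origin, which settles invariance.

The equation for `⟨x,u⟩` is the substantial one (`pizzetti_innerXU_mul`): split `⟨x,u⟩H` into its
four Fischer components. The two mixed components contribute nothing, and the contributions of the
other two cancel by the recursion `gammaCoeff_succ`; this is what dictates the constants `γ_i`.

The commutators collected first are relations of `sp(4)`, spanned by the squares, the Laplacians,
`D`, `⟨x,u⟩`, `opE`, `opF` and the shifted Euler operators; it commutes with `so(m)`. -/

/-- The polynomial `|x|²`. -/
def normSqX : Poly m := ∑ i, X (Sum.inl i) ^ 2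

/-- The polynomial `|u|²`. -/
def normSqU : Poly m := ∑ i, X (Sum.inr i) ^ 2

/-- The polynomial `⟨x, u⟩`. -/
def innerXU : Poly m := ∑ i, X (Sum.inl i) * X (Sum.inr i)

/-- The operator `⟨x, ∂_u⟩`. -/
def opE : Module.End ℂ (Poly m) := ∑ i, mX i * dU i

/-- The operator `⟨u, ∂_x⟩`. -/
def opF : Module.End ℂ (Poly m) := ∑ i, mU i * dX i

theorem sqX_apply (P : Poly m) : sqX P = normSqX * P := by
  simp [sqX, normSqX, mX, Finset.sum_mul, pow_two, mul_assoc, LinearMap.sum_apply]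

theorem sqU_apply (P : Poly m) : sqU P = normSqU * P := by
  simp [sqU, normSqU, mU, Finset.sum_mul, pow_two, mul_assoc, LinearMap.sum_apply]

theorem lapX_apply (P : Poly m) : lapX P = ∑ i, dX i (dX i P) := by
  simp [lapX, pow_two, LinearMap.sum_apply]

theorem lapU_apply (P : Poly m) : lapU P = ∑ i, dU i (dU i P) := by
  simp [lapU, pow_two, LinearMap.sum_apply]

theorem dUdX_apply (P : Poly m) : dUdX P = ∑ i, dU i (dX i P) := by
  simp [dUdX, LinearMap.sum_apply]

theorem eulerX_apply (P : Poly m) : eulerX P = ∑ i, X (Sum.inl i) * dX i P := by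
  simp [eulerX, mX, LinearMap.sum_apply]

theorem eulerU_apply (P : Poly m) : eulerU P = ∑ i, X (Sum.inr i) * dU i P := by
  simp [eulerU, mU, LinearMap.sum_apply]

theorem opE_apply (P : Poly m) : opE P = ∑ i, X (Sum.inl i) * dU i P := by
  simp [opE, mX, LinearMap.sum_apply]

theorem opF_apply (P : Poly m) : opF P = ∑ i, X (Sum.inr i) * dX i P := by
  simp [opF, mU, LinearMap.sum_apply]

theorem dX_mul (i : Fin m) (P Q : Poly m) : dX i (P * Q) = dX i P * Q + P * dX i Q :=
  pderiv_mul

theorem dU_mul (i : Fin m) (P Q : Poly m) : dU i (P * Q) = dU i P * Q + P * dU i Q :=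
  pderiv_mul

theorem dX_X_inl (i j : Fin m) : dX i (X (Sum.inl j) : Poly m) = if i = j then 1 else 0 := by
  simp [dX, pderiv_X, Pi.single_apply, eq_comm]

theorem dX_X_inr (i j : Fin m) : dX i (X (Sum.inr j) : Poly m) = 0 := by
  simp [dX, pderiv_X]

theorem dU_X_inl (i j : Fin m) : dU i (X (Sum.inl j) : Poly m) = 0 := by
  simp [dU, pderiv_X]

theorem dU_X_inr (i j : Fin m) : dU i (X (Sum.inr j) : Poly m) = if i = j then 1 else 0 := by
  simp [dU, pderiv_X, Pi.single_apply, eq_comm]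

/-- The commutator of two derivations is again a derivation, so it suffices that it vanishes on the
variables. -/
theorem pderiv_comm {σ : Type*} (i j : σ) (P : MvPolynomial σ ℂ) :
    pderiv i (pderiv j P) = pderiv j (pderiv i P) := by
  classical
  have h : ⁅pderiv (R := ℂ) i, pderiv (R := ℂ) j⁆ = 0 := by
    refine derivation_ext fun k => ?_
    rw [Derivation.commutator_apply]
    simp only [pderiv_X, Pi.single_apply]
    split_ifs <;> simp
  have := congrArg (fun d => d P) h
  rw [Derivation.commutator_apply] at this
  exact sub_eq_zero.1 this

theorem dX_dX (i j : Fin m) (P : Poly m) : dX i (dX j P) = dX j (dX i P) := pderiv_comm _ _ P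

theorem dU_dU (i j : Fin m) (P : Poly m) : dU i (dU j P) = dU j (dU i P) := pderiv_comm _ _ P

theorem dX_dU (i j : Fin m) (P : Poly m) : dX i (dU j P) = dU j (dX i P) := pderiv_comm _ _ P

theorem dX_normSqX (i : Fin m) : dX i (normSqX : Poly m) = 2 * X (Sum.inl i) := by
  simp only [normSqX, pow_two, map_sum, dX_mul, dX_X_inl, ite_mul, mul_ite, one_mul, mul_one,
    zero_mul, mul_zero, Finset.sum_add_distrib, Finset.sum_ite_eq, Finset.mem_univ, if_true]
  ring

theorem dX_normSqU (i : Fin m) : dX i (normSqU : Poly m) = 0 := by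
  simp [normSqU, pow_two, dX_mul, dX_X_inr]

theorem dU_normSqX (i : Fin m) : dU i (normSqX : Poly m) = 0 := by
  simp [normSqX, pow_two, dU_mul, dU_X_inl]

theorem dU_normSqU (i : Fin m) : dU i (normSqU : Poly m) = 2 * X (Sum.inr i) := by
  simp only [normSqU, pow_two, map_sum, dU_mul, dU_X_inr, ite_mul, mul_ite, one_mul, mul_one,
    zero_mul, mul_zero, Finset.sum_add_distrib, Finset.sum_ite_eq, Finset.mem_univ, if_true]
  ring

theorem dX_innerXU (i : Fin m) : dX i (innerXU : Poly m) = X (Sum.inr i) := by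
  simp [innerXU, dX_mul, dX_X_inl, dX_X_inr]

theorem dU_innerXU (i : Fin m) : dU i (innerXU : Poly m) = X (Sum.inl i) := by
  simp [innerXU, dU_mul, dU_X_inl, dU_X_inr]

theorem dX_two (i : Fin m) : dX i (2 : Poly m) = 0 := by
  exact_mod_cast (pderiv (R := ℂ) (Sum.inl i : Fin m ⊕ Fin m)).map_natCast 2

theorem dU_two (i : Fin m) : dU i (2 : Poly m) = 0 := by
  exact_mod_cast (pderiv (R := ℂ) (Sum.inr i : Fin m ⊕ Fin m)).map_natCast 2

/-! ### Commutators with the Laplace operators -/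

theorem lapX_X_inl_mul (i : Fin m) (P : Poly m) :
    lapX (X (Sum.inl i) * P) = X (Sum.inl i) * lapX P + 2 * dX i P := by
  simp only [lapX_apply, dX_mul, dX_X_inl, map_add, ite_mul, one_mul, zero_mul,
    apply_ite (dX _), map_zero, Finset.sum_add_distrib, Finset.sum_ite_eq',
    Finset.mem_univ, if_true, Finset.mul_sum]
  ring

theorem lapX_X_inr_mul (i : Fin m) (P : Poly m) :
    lapX (X (Sum.inr i) * P) = X (Sum.inr i) * lapX P := by
  simp only [lapX_apply, dX_mul, dX_X_inr, zero_mul, zero_add, Finset.mul_sum]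

theorem lapU_X_inl_mul (i : Fin m) (P : Poly m) :
    lapU (X (Sum.inl i) * P) = X (Sum.inl i) * lapU P := by
  simp only [lapU_apply, dU_mul, dU_X_inl, zero_mul, zero_add, Finset.mul_sum]

theorem lapU_X_inr_mul (i : Fin m) (P : Poly m) :
    lapU (X (Sum.inr i) * P) = X (Sum.inr i) * lapU P + 2 * dU i P := by
  simp only [lapU_apply, dU_mul, dU_X_inr, map_add, ite_mul, one_mul, zero_mul,
    apply_ite (dU _), map_zero, Finset.sum_add_distrib, Finset.sum_ite_eq',
    Finset.mem_univ, if_true, Finset.mul_sum]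
  ring

theorem lapX_dX (i : Fin m) (P : Poly m) : lapX (dX i P) = dX i (lapX P) := by
  simp only [lapX_apply, map_sum, dX_dX _ i]

theorem lapX_dU (i : Fin m) (P : Poly m) : lapX (dU i P) = dU i (lapX P) := by
  simp only [lapX_apply, map_sum, dX_dU]

theorem lapU_dX (i : Fin m) (P : Poly m) : lapU (dX i P) = dX i (lapU P) := by
  simp only [lapU_apply, map_sum, dX_dU]

theorem lapU_dU (i : Fin m) (P : Poly m) : lapU (dU i P) = dU i (lapU P) := by
  simp only [lapU_apply, map_sum, dU_dU _ i]

theorem dUdX_dX (i : Fin m) (P : Poly m) : dUdX (dX i P) = dX i (dUdX P) := by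
  simp only [dUdX_apply, map_sum, dX_dU, dX_dX i]

theorem dUdX_dU (i : Fin m) (P : Poly m) : dUdX (dU i P) = dU i (dUdX P) := by
  simp only [dUdX_apply, map_sum, dX_dU, dU_dU i]

theorem lapX_lapU (P : Poly m) : lapX (lapU P) = lapU (lapX P) := by
  simp only [lapU_apply, map_sum, lapX_dU]

theorem lapX_dUdX (P : Poly m) : lapX (dUdX P) = dUdX (lapX P) := by
  simp only [dUdX_apply, map_sum, lapX_dU, lapX_dX]

theorem lapU_dUdX (P : Poly m) : lapU (dUdX P) = dUdX (lapU P) := by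
  simp only [dUdX_apply, map_sum, lapU_dU, lapU_dX]

/-- Spreads the dimension `m` over the index set, so that the commutators producing a multiple of
`m` can be checked summand by summand. -/
theorem natCast_smul_eq_sum (c : ℂ) (P : Poly m) :
    (c * (m : ℂ)) • P = ∑ _i : Fin m, C c * P := by
  rw [Finset.sum_const, Finset.card_univ, Fintype.card_fin, smul_eq_C_mul, nsmul_eq_mul, map_mul,
    map_natCast]
  ring

theorem lapX_normSqX_mul (P : Poly m) :
    lapX (normSqX * P) = normSqX * lapX P + (4 : ℂ) • eulerX P + (2 * (m : ℂ)) • P := by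
  rw [natCast_smul_eq_sum]
  simp only [lapX_apply, eulerX_apply, dX_mul, dX_normSqX, map_add, dX_two, dX_X_inl, if_true,
    Finset.mul_sum, Finset.smul_sum, ← Finset.sum_add_distrib, smul_eq_C_mul, map_ofNat]
  exact Finset.sum_congr rfl fun i _ => by ring

theorem lapU_normSqU_mul (P : Poly m) :
    lapU (normSqU * P) = normSqU * lapU P + (4 : ℂ) • eulerU P + (2 * (m : ℂ)) • P := by
  rw [natCast_smul_eq_sum]
  simp only [lapU_apply, eulerU_apply, dU_mul, dU_normSqU, map_add, dU_two, dU_X_inr, if_true,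
    Finset.mul_sum, Finset.smul_sum, ← Finset.sum_add_distrib, smul_eq_C_mul, map_ofNat]
  exact Finset.sum_congr rfl fun i _ => by ring

theorem lapX_normSqU_mul (P : Poly m) : lapX (normSqU * P) = normSqU * lapX P := by
  simp only [lapX_apply, dX_mul, dX_normSqU, zero_mul, zero_add, Finset.mul_sum]

theorem lapU_normSqX_mul (P : Poly m) : lapU (normSqX * P) = normSqX * lapU P := by
  simp only [lapU_apply, dU_mul, dU_normSqX, zero_mul, zero_add, Finset.mul_sum]

theorem lapX_innerXU_mul (P : Poly m) :
    lapX (innerXU * P) = innerXU * lapX P + (2 : ℂ) • opF P := by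
  simp only [lapX_apply, opF_apply, dX_mul, dX_innerXU, map_add, dX_X_inr,
    Finset.mul_sum, Finset.smul_sum, ← Finset.sum_add_distrib, smul_eq_C_mul, map_ofNat]
  exact Finset.sum_congr rfl fun i _ => by ring

theorem lapU_innerXU_mul (P : Poly m) :
    lapU (innerXU * P) = innerXU * lapU P + (2 : ℂ) • opE P := by
  simp only [lapU_apply, opE_apply, dU_mul, dU_innerXU, map_add, dU_X_inl,
    Finset.mul_sum, Finset.smul_sum, ← Finset.sum_add_distrib, smul_eq_C_mul, map_ofNat]
  exact Finset.sum_congr rfl fun i _ => by ring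

theorem lapX_opF (P : Poly m) : lapX (opF P) = opF (lapX P) := by
  simp only [opF_apply, map_sum, lapX_X_inr_mul, lapX_dX]

theorem lapU_opE (P : Poly m) : lapU (opE P) = opE (lapU P) := by
  simp only [opE_apply, map_sum, lapU_X_inl_mul, lapU_dU]

theorem lapX_opE (P : Poly m) : lapX (opE P) = opE (lapX P) + (2 : ℂ) • dUdX P := by
  simp only [opE_apply, dUdX_apply, map_sum, lapX_X_inl_mul, lapX_dU, Finset.sum_add_distrib,
    smul_eq_C_mul, map_ofNat, Finset.mul_sum, dX_dU]

theorem lapU_opF (P : Poly m) : lapU (opF P) = opF (lapU P) + (2 : ℂ) • dUdX P := by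
  simp only [opF_apply, dUdX_apply, map_sum, lapU_X_inr_mul, lapU_dX, Finset.sum_add_distrib,
    smul_eq_C_mul, map_ofNat, Finset.mul_sum]

/-! ### Commutators with `⟨∂_u, ∂_x⟩` -/

theorem dUdX_X_inl_mul (i : Fin m) (P : Poly m) :
    dUdX (X (Sum.inl i) * P) = X (Sum.inl i) * dUdX P + dU i P := by
  simp only [dUdX_apply, dX_mul, dU_mul, dX_X_inl, dU_X_inl, map_add, ite_mul, one_mul, zero_mul,
    zero_add, apply_ite (dU _), map_zero, Finset.sum_add_distrib, Finset.sum_ite_eq',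
    Finset.mem_univ, if_true, Finset.mul_sum]
  ring

theorem dUdX_X_inr_mul (i : Fin m) (P : Poly m) :
    dUdX (X (Sum.inr i) * P) = X (Sum.inr i) * dUdX P + dX i P := by
  simp only [dUdX_apply, dX_mul, dU_mul, dX_X_inr, dU_X_inr, ite_mul, one_mul, zero_mul,
    zero_add, Finset.sum_add_distrib, Finset.sum_ite_eq',
    Finset.mem_univ, if_true, Finset.mul_sum]
  ring

theorem dUdX_normSqX_mul (P : Poly m) :
    dUdX (normSqX * P) = normSqX * dUdX P + (2 : ℂ) • opE P := by
  simp only [dUdX_apply, opE_apply, dX_mul, dU_mul, dX_normSqX, dU_normSqX, map_add, dU_two,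
    dU_X_inl, Finset.mul_sum, Finset.smul_sum, ← Finset.sum_add_distrib, smul_eq_C_mul, map_ofNat]
  exact Finset.sum_congr rfl fun i _ => by ring

theorem dUdX_normSqU_mul (P : Poly m) :
    dUdX (normSqU * P) = normSqU * dUdX P + (2 : ℂ) • opF P := by
  simp only [dUdX_apply, opF_apply, dX_mul, dU_mul, dX_normSqU, dU_normSqU,
    Finset.mul_sum, Finset.smul_sum, ← Finset.sum_add_distrib, smul_eq_C_mul, map_ofNat,
    zero_mul, zero_add]
  exact Finset.sum_congr rfl fun i _ => by ring

theorem dUdX_innerXU_mul (P : Poly m) :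
    dUdX (innerXU * P) = innerXU * dUdX P + eulerX P + eulerU P + (m : ℂ) • P := by
  have h := natCast_smul_eq_sum (m := m) 1 P
  rw [one_mul] at h
  rw [h]
  simp only [dUdX_apply, eulerX_apply, eulerU_apply, dX_mul, dU_mul, dX_innerXU, dU_innerXU,
    map_add, dU_X_inr, if_true, Finset.mul_sum, ← Finset.sum_add_distrib, map_one]
  exact Finset.sum_congr rfl fun i _ => by ring

theorem dUdX_opE (P : Poly m) : dUdX (opE P) = opE (dUdX P) + lapU P := by
  simp only [opE_apply, lapU_apply, map_sum, dUdX_X_inl_mul, dUdX_dU, Finset.sum_add_distrib]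

theorem dUdX_opF (P : Poly m) : dUdX (opF P) = opF (dUdX P) + lapX P := by
  simp only [opF_apply, lapX_apply, map_sum, dUdX_X_inr_mul, dUdX_dX, Finset.sum_add_distrib]

/-! ### Euler operators -/

theorem eulerX_mul (P Q : Poly m) : eulerX (P * Q) = eulerX P * Q + P * eulerX Q := by
  simp only [eulerX_apply, dX_mul, Finset.mul_sum, Finset.sum_mul, ← Finset.sum_add_distrib]
  exact Finset.sum_congr rfl fun i _ => by ring

theorem eulerU_mul (P Q : Poly m) : eulerU (P * Q) = eulerU P * Q + P * eulerU Q := by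
  simp only [eulerU_apply, dU_mul, Finset.mul_sum, Finset.sum_mul, ← Finset.sum_add_distrib]
  exact Finset.sum_congr rfl fun i _ => by ring

theorem eulerX_X_inl (i : Fin m) : eulerX (X (Sum.inl i) : Poly m) = X (Sum.inl i) := by
  simp [eulerX_apply, dX_X_inl]

theorem eulerX_X_inr (i : Fin m) : eulerX (X (Sum.inr i) : Poly m) = 0 := by
  simp [eulerX_apply, dX_X_inr]

theorem eulerU_X_inl (i : Fin m) : eulerU (X (Sum.inl i) : Poly m) = 0 := by
  simp [eulerU_apply, dU_X_inl]

theorem eulerU_X_inr (i : Fin m) : eulerU (X (Sum.inr i) : Poly m) = X (Sum.inr i) := by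
  simp [eulerU_apply, dU_X_inr]

theorem eulerX_dX (i : Fin m) (P : Poly m) : eulerX (dX i P) = dX i (eulerX P) - dX i P := by
  simp only [eulerX_apply, map_sum, dX_mul, dX_X_inl, ite_mul, one_mul, zero_mul,
    Finset.sum_add_distrib, Finset.sum_ite_eq, Finset.mem_univ, if_true, dX_dX i]
  ring

theorem eulerX_dU (i : Fin m) (P : Poly m) : eulerX (dU i P) = dU i (eulerX P) := by
  simp only [eulerX_apply, map_sum, dU_mul, dU_X_inl, zero_mul, zero_add, dX_dU]

theorem eulerU_dX (i : Fin m) (P : Poly m) : eulerU (dX i P) = dX i (eulerU P) := by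
  simp only [eulerU_apply, map_sum, dX_mul, dX_X_inr, zero_mul, zero_add, dX_dU]

theorem eulerU_dU (i : Fin m) (P : Poly m) : eulerU (dU i P) = dU i (eulerU P) - dU i P := by
  simp only [eulerU_apply, map_sum, dU_mul, dU_X_inr, ite_mul, one_mul, zero_mul,
    Finset.sum_add_distrib, Finset.sum_ite_eq, Finset.mem_univ, if_true, dU_dU i]
  ring

/-! ### Bihomogeneous polynomials and functions of the Euler operators -/

/-- `P` is homogeneous of degree `p` in `x` and of degree `q` in `u`, in the sense that it is an
eigenvector of both Euler operators; the degrees are allowed to be arbitrary complex numbers. -/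
structure Bihom (p q : ℂ) (P : Poly m) : Prop where
  x : eulerX P = p • P
  u : eulerU P = q • P

namespace Bihom

variable {p q p' q' : ℂ} {P Q : Poly m}

theorem congr_deg (h : Bihom p q P) (hp : p = p') (hq : q = q') : Bihom p' q' P := by
  subst hp hq; exact h

theorem zero : Bihom p q (0 : Poly m) := ⟨by simp, by simp⟩

theorem add (hP : Bihom p q P) (hQ : Bihom p q Q) : Bihom p q (P + Q) :=
  ⟨by simp [hP.x, hQ.x], by simp [hP.u, hQ.u]⟩

theorem smul (c : ℂ) (hP : Bihom p q P) : Bihom p q (c • P) :=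
  ⟨by simp [hP.x, smul_comm c], by simp [hP.u, smul_comm c]⟩

theorem sub (hP : Bihom p q P) (hQ : Bihom p q Q) : Bihom p q (P - Q) :=
  ⟨by simp [hP.x, hQ.x, smul_sub], by simp [hP.u, hQ.u, smul_sub]⟩

theorem sum {ι : Type*} (s : Finset ι) {f : ι → Poly m} (h : ∀ i ∈ s, Bihom p q (f i)) :
    Bihom p q (∑ i ∈ s, f i) :=
  ⟨by rw [map_sum, Finset.smul_sum]; exact Finset.sum_congr rfl fun i hi => (h i hi).x,
    by rw [map_sum, Finset.smul_sum]; exact Finset.sum_congr rfl fun i hi => (h i hi).u⟩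

theorem mul (hP : Bihom p q P) (hQ : Bihom p' q' Q) : Bihom (p + p') (q + q') (P * Q) :=
  ⟨by rw [eulerX_mul, hP.x, hQ.x, smul_mul_assoc, mul_smul_comm, add_smul],
    by rw [eulerU_mul, hP.u, hQ.u, smul_mul_assoc, mul_smul_comm, add_smul]⟩

theorem X_inl (i : Fin m) : Bihom 1 0 (X (Sum.inl i) : Poly m) :=
  ⟨by simp [eulerX_X_inl], by simp [eulerU_X_inl]⟩

theorem X_inr (i : Fin m) : Bihom 0 1 (X (Sum.inr i) : Poly m) :=
  ⟨by simp [eulerX_X_inr], by simp [eulerU_X_inr]⟩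

theorem normSqX : Bihom 2 0 (normSqX : Poly m) :=
  .sum _ fun i _ => by
    rw [pow_two]; exact ((X_inl i).mul (X_inl i)).congr_deg (by norm_num) (by norm_num)

theorem normSqU : Bihom 0 2 (normSqU : Poly m) :=
  .sum _ fun i _ => by
    rw [pow_two]; exact ((X_inr i).mul (X_inr i)).congr_deg (by norm_num) (by norm_num)

theorem innerXU : Bihom 1 1 (innerXU : Poly m) :=
  .sum _ fun i _ => ((X_inl i).mul (X_inr i)).congr_deg (by norm_num) (by norm_num)

theorem dX (i : Fin m) (h : Bihom p q P) : Bihom (p - 1) q (dX i P) :=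
  ⟨by rw [eulerX_dX, h.x, map_smul, sub_smul, one_smul], by rw [eulerU_dX, h.u, map_smul]⟩

theorem dU (i : Fin m) (h : Bihom p q P) : Bihom p (q - 1) (dU i P) :=
  ⟨by rw [eulerX_dU, h.x, map_smul], by rw [eulerU_dU, h.u, map_smul, sub_smul, one_smul]⟩

theorem lapX (h : Bihom p q P) : Bihom (p - 2) q (lapX P) := by
  rw [lapX_apply]
  exact .sum _ fun i _ => ((h.dX i).dX i).congr_deg (by ring) rfl

theorem lapU (h : Bihom p q P) : Bihom p (q - 2) (lapU P) := by
  rw [lapU_apply]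
  exact .sum _ fun i _ => ((h.dU i).dU i).congr_deg rfl (by ring)

theorem dUdX (h : Bihom p q P) : Bihom (p - 1) (q - 1) (dUdX P) := by
  rw [dUdX_apply]
  exact .sum _ fun i _ => (h.dX i).dU i

theorem opE (h : Bihom p q P) : Bihom (p + 1) (q - 1) (opE P) := by
  rw [opE_apply]
  exact .sum _ fun i _ => ((X_inl i).mul (h.dU i)).congr_deg (by ring) (by ring)

theorem opF (h : Bihom p q P) : Bihom (p - 1) (q + 1) (opF P) := by
  rw [opF_apply]
  exact .sum _ fun i _ => ((X_inr i).mul (h.dX i)).congr_deg (by ring) (by ring)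

end Bihom

theorem eulerX_monomial (s : (Fin m ⊕ Fin m) →₀ ℕ) (c : ℂ) :
    eulerX (monomial s c : Poly m) = (degX s : ℂ) • monomial s c := by
  simp only [eulerX_apply, dX, Derivation.coeFn_coe, X_mul_pderiv_monomial, degX]
  rw [← Finset.sum_smul, Nat.cast_smul_eq_nsmul]

theorem eulerU_monomial (s : (Fin m ⊕ Fin m) →₀ ℕ) (c : ℂ) :
    eulerU (monomial s c : Poly m) = (degU s : ℂ) • monomial s c := by
  simp only [eulerU_apply, dU, Derivation.coeFn_coe, X_mul_pderiv_monomial, degU]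
  rw [← Finset.sum_smul, Nat.cast_smul_eq_nsmul]

theorem Bihom.monomial (s : (Fin m ⊕ Fin m) →₀ ℕ) (c : ℂ) :
    Bihom (degX s) (degU s) (monomial s c : Poly m) :=
  ⟨eulerX_monomial s c, eulerU_monomial s c⟩

theorem coeff_eulerX (s : (Fin m ⊕ Fin m) →₀ ℕ) (P : Poly m) :
    coeff s (eulerX P) = (degX s : ℂ) * coeff s P := by
  classical
  induction P using MvPolynomial.induction_on' with
  | monomial t c =>
    rw [eulerX_monomial, coeff_smul, coeff_monomial]
    split_ifs with h <;> simp [h]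
  | add P Q hP hQ => simp [hP, hQ, mul_add]

theorem coeff_eulerU (s : (Fin m ⊕ Fin m) →₀ ℕ) (P : Poly m) :
    coeff s (eulerU P) = (degU s : ℂ) * coeff s P := by
  classical
  induction P using MvPolynomial.induction_on' with
  | monomial t c =>
    rw [eulerU_monomial, coeff_smul, coeff_monomial]
    split_ifs with h <;> simp [h]
  | add P Q hP hQ => simp [hP, hQ, mul_add]

theorem Bihom.degX_eq {p q : ℂ} {P : Poly m} (h : Bihom p q P) {s : (Fin m ⊕ Fin m) →₀ ℕ}
    (hs : s ∈ P.support) : (degX s : ℂ) = p := by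
  have := congrArg (coeff s) h.x
  rw [coeff_eulerX, coeff_smul, smul_eq_mul] at this
  exact mul_right_cancel₀ (mem_support_iff.1 hs) this

theorem Bihom.degU_eq {p q : ℂ} {P : Poly m} (h : Bihom p q P) {s : (Fin m ⊕ Fin m) →₀ ℕ}
    (hs : s ∈ P.support) : (degU s : ℂ) = q := by
  have := congrArg (coeff s) h.u
  rw [coeff_eulerU, coeff_smul, smul_eq_mul] at this
  exact mul_right_cancel₀ (mem_support_iff.1 hs) this

/-- Complex degrees let lowering operators act without truncated subtraction; the price is degrees
such as `-1`, and this lemma disposes of them, since every exponent in the support would have that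
degree. -/
theorem Bihom.eq_zero_of_x {p q : ℂ} {P : Poly m} (h : Bihom p q P) (hp : ∀ n : ℕ, (n : ℂ) ≠ p) :
    P = 0 :=
  support_eq_empty.1 (Finset.eq_empty_of_forall_notMem fun _ hs => hp _ (h.degX_eq hs))

theorem Bihom.eq_zero_of_u {p q : ℂ} {P : Poly m} (h : Bihom p q P) (hq : ∀ n : ℕ, (n : ℂ) ≠ q) :
    P = 0 :=
  support_eq_empty.1 (Finset.eq_empty_of_forall_notMem fun _ hs => hq _ (h.degU_eq hs))

theorem Bihom.coeff_zero {p q : ℂ} {P : Poly m} (h : Bihom p q P) (hpq : p ≠ 0 ∨ q ≠ 0) :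
    coeff 0 P = 0 := by
  by_contra h0
  have h0 := mem_support_iff.2 h0
  have hx := h.degX_eq h0
  have hu := h.degU_eq h0
  simp only [degX, degU, Finsupp.coe_zero, Pi.zero_apply, Finset.sum_const_zero,
    Nat.cast_zero] at hx hu
  exact hpq.elim (fun h => h hx.symm) fun h => h hu.symm

theorem funEulerX_apply {p : ℕ} {q : ℂ} {P : Poly m} (f : ℕ → ℂ) (h : Bihom p q P) :
    funEulerX f P = f p • P := by
  conv_lhs => rw [P.as_sum]
  conv_rhs => rw [P.as_sum]
  rw [map_sum, Finset.smul_sum]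
  refine Finset.sum_congr rfl fun s hs => ?_
  have hb := (basisMonomials (Fin m ⊕ Fin m) ℂ).constr_basis ℂ
    (fun s => f (degX s) • (MvPolynomial.monomial s 1 : Poly m)) s
  rw [coe_basisMonomials] at hb
  rw [← mul_one (coeff s P), ← smul_eq_mul, ← smul_monomial, map_smul, funEulerX, hb,
    Nat.cast_injective (h.degX_eq hs), smul_comm]

theorem funEulerU_apply {q : ℕ} {p : ℂ} {P : Poly m} (f : ℕ → ℂ) (h : Bihom p q P) :
    funEulerU f P = f q • P := by
  conv_lhs => rw [P.as_sum]
  conv_rhs => rw [P.as_sum]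
  rw [map_sum, Finset.smul_sum]
  refine Finset.sum_congr rfl fun s hs => ?_
  have hb := (basisMonomials (Fin m ⊕ Fin m) ℂ).constr_basis ℂ
    (fun s => f (degU s) • (MvPolynomial.monomial s 1 : Poly m)) s
  rw [coe_basisMonomials] at hb
  rw [← mul_one (coeff s P), ← smul_eq_mul, ← smul_monomial, map_smul, funEulerU, hb,
    Nat.cast_injective (h.degU_eq hs), smul_comm]

/-- All monomials of `P` have the same degree `p` in `x`, so the cut-offs chosen monomial by
monomial in `piX` agree. -/
theorem piX_apply {p : ℕ} {q : ℂ} {P : Poly m} (h : Bihom p q P) :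
    piX P = ∑ j ∈ Finset.range (p + 1), extremalTermX j P := by
  conv_lhs => rw [P.as_sum]
  rw [← LinearMap.sum_apply]
  conv_rhs => rw [P.as_sum]
  rw [map_sum, map_sum]
  refine Finset.sum_congr rfl fun s hs => ?_
  have hb := (basisMonomials (Fin m ⊕ Fin m) ℂ).constr_basis ℂ
    (fun s => ∑ j ∈ Finset.range (degX s + 1), extremalTermX j (MvPolynomial.monomial s 1 : Poly m))
    s
  rw [coe_basisMonomials] at hb
  rw [← mul_one (coeff s P), ← smul_eq_mul, ← smul_monomial, map_smul, map_smul, piX, hb,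
    Nat.cast_injective (h.degX_eq hs), LinearMap.sum_apply]

theorem piU_apply {q : ℕ} {p : ℂ} {P : Poly m} (h : Bihom p q P) :
    piU P = ∑ j ∈ Finset.range (q + 1), extremalTermU j P := by
  conv_lhs => rw [P.as_sum]
  rw [← LinearMap.sum_apply]
  conv_rhs => rw [P.as_sum]
  rw [map_sum, map_sum]
  refine Finset.sum_congr rfl fun s hs => ?_
  have hb := (basisMonomials (Fin m ⊕ Fin m) ℂ).constr_basis ℂ
    (fun s => ∑ j ∈ Finset.range (degU s + 1), extremalTermU j (MvPolynomial.monomial s 1 : Poly m))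
    s
  rw [coe_basisMonomials] at hb
  rw [← mul_one (coeff s P), ← smul_eq_mul, ← smul_monomial, map_smul, map_smul, piU, hb,
    Nat.cast_injective (h.degU_eq hs), LinearMap.sum_apply]

/-! ## Abstract Fischer decomposition -/

section Abstract

variable {V : Type*} [AddCommGroup V] [Module ℂ V] {L N : Module.End ℂ V}

/-- If `L` lowers and `N` raises the degree by two and if `L N^(a+1) h` is a non-zero multiple of
`N^a h` for `h` in the kernel of `L`, then all homogeneous vectors are sums of vectors `N^a h`. -/
theorem fischer_span {W : ℕ → Submodule ℂ V}
    (hN : ∀ n, ∀ v ∈ W n, N v ∈ W (n + 2)) (hL : ∀ n, ∀ v ∈ W (n + 2), L v ∈ W n)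
    (h0 : ∀ v ∈ W 0, L v = 0) (h1 : ∀ v ∈ W 1, L v = 0) {c : ℕ → ℕ → ℂ} (hc : ∀ n a, c n a ≠ 0)
    (hLN : ∀ n, ∀ h ∈ W n, L h = 0 → ∀ a, L ((N ^ (a + 1)) h) = c n a • (N ^ a) h)
    {S : Submodule ℂ V} (hS : ∀ n, ∀ h ∈ W n, L h = 0 → ∀ a, (N ^ a) h ∈ S) (n : ℕ) :
    W n ≤ S := by
  let B : ℕ → Set V := fun n => {v | ∃ k a, k + 2 * a = n ∧ ∃ h ∈ W k, L h = 0 ∧ (N ^ a) h = v}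
  have hBS : ∀ n, Submodule.span ℂ (B n) ≤ S := fun n => Submodule.span_le.2 <| by
    rintro _ ⟨k, a, -, h, hh, hL, rfl⟩
    exact hS k h hh hL a
  have hpow : ∀ a k, ∀ v ∈ W k, (N ^ a) v ∈ W (k + 2 * a) := by
    intro a
    induction a with
    | zero => intro k v hv; simpa using hv
    | succ a ih => intro k v hv; rw [pow_succ']; exact hN _ _ (ih k v hv)
  have hBW : ∀ n, Submodule.span ℂ (B n) ≤ W n := fun n => Submodule.span_le.2 <| by
    rintro _ ⟨k, a, rfl, h, hh, -, rfl⟩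
    exact hpow a k h hh
  -- `L` maps the span of the generators in degree `n + 2` onto that in degree `n`: a generator is
  -- hit by the next power of `N`, because `c` never vanishes.
  have hlift : ∀ n, ∀ v ∈ Submodule.span ℂ (B n), ∃ w ∈ Submodule.span ℂ (B (n + 2)), L w = v := by
    intro n v hv
    induction hv using Submodule.span_induction with
    | mem v hv =>
      obtain ⟨k, a, rfl, h, hh, hL, rfl⟩ := hv
      refine ⟨(c k a)⁻¹ • (N ^ (a + 1)) h, Submodule.smul_mem _ _ (Submodule.subset_span
        ⟨k, a + 1, by ring, h, hh, hL, rfl⟩), ?_⟩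
      rw [map_smul, hLN k h hh hL, smul_smul, inv_mul_cancel₀ (hc k a), one_smul]
    | zero => exact ⟨0, zero_mem _, map_zero _⟩
    | add v w _ _ hv hw =>
      obtain ⟨v', hv', rfl⟩ := hv
      obtain ⟨w', hw', rfl⟩ := hw
      exact ⟨v' + w', add_mem hv' hw', map_add _ _ _⟩
    | smul r v _ hv =>
      obtain ⟨v', hv', rfl⟩ := hv
      exact ⟨r • v', Submodule.smul_mem _ _ hv', map_smul _ _ _⟩
  have hker : ∀ n, ∀ v ∈ W n, L v = 0 → v ∈ Submodule.span ℂ (B n) := fun n v hv hL =>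
    Submodule.subset_span ⟨n, 0, by ring, v, hv, hL, by simp⟩
  suffices H : ∀ n, W n ≤ Submodule.span ℂ (B n) from (H n).trans (hBS n)
  intro n
  induction n using Nat.twoStepInduction with
  | zero => exact fun v hv => hker 0 v hv (h0 v hv)
  | one => exact fun v hv => hker 1 v hv (h1 v hv)
  | more n ih _ =>
    intro v hv
    -- Correct `v` by a lift `w` of `L v`: the difference lies in the kernel of `L`, hence is itself
    -- a generator with exponent `0`.
    obtain ⟨w, hw, hwv⟩ := hlift n _ (ih (hL n v hv))
    rw [← sub_add_cancel v w]
    exact add_mem (hker _ _ (sub_mem hv (hBW _ hw)) (by rw [map_sub, hwv, sub_self])) hw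

/-! ### Scalars of the `sl₂` action on `N^c h` -/

/-- The scalar by which `N^s L^s` acts on `N^c h`. -/
def lowerCoeff (κ : ℂ) (c s : ℕ) : ℂ :=
  ∏ k ∈ Finset.range s, (4 * ((c : ℂ) - k) * (κ + c - 1 - k))

theorem lowerCoeff_eq_zero (κ : ℂ) {c s : ℕ} (h : c < s) : lowerCoeff κ c s = 0 :=
  Finset.prod_eq_zero (Finset.mem_range.2 h) (by simp)

theorem pow_lower_apply {κ : ℂ} {h : V}
    (hL : ∀ c : ℕ, L ((N ^ c) h) = (4 * (c : ℂ) * (κ + c - 1)) • (N ^ (c - 1)) h) (c s : ℕ) :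
    (L ^ s) ((N ^ c) h) = lowerCoeff κ c s • (N ^ (c - s)) h := by
  induction s with
  | zero => simp [lowerCoeff]
  | succ s ih =>
    rw [pow_succ', Module.End.mul_apply, ih, map_smul, hL, smul_smul]
    -- The exponent `c - s` is truncated; beyond `s = c` the scalar is zero, so its value there is
    -- irrelevant.
    rcases lt_or_ge c s with hcs | hcs
    · rw [lowerCoeff_eq_zero κ hcs, lowerCoeff_eq_zero κ (hcs.trans s.lt_succ_self)]
      simp
    · rw [Nat.sub_sub]
      congr 1
      rw [lowerCoeff, lowerCoeff, Finset.prod_range_succ, Nat.cast_sub hcs]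
      ring

theorem pow_raise_pow_lower_apply {κ : ℂ} {h : V}
    (hL : ∀ c : ℕ, L ((N ^ c) h) = (4 * (c : ℂ) * (κ + c - 1)) • (N ^ (c - 1)) h) (c s : ℕ) :
    (N ^ s) ((L ^ s) ((N ^ c) h)) = lowerCoeff κ c s • (N ^ c) h := by
  rw [pow_lower_apply hL, map_smul, ← Module.End.mul_apply, ← pow_add]
  rcases lt_or_ge c s with hcs | hcs
  · rw [lowerCoeff_eq_zero κ hcs, zero_smul, zero_smul]
  · rw [Nat.add_sub_cancel' hcs]

/-- The partial sums of the extremal projection operator on `N^c h`. -/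
theorem sum_extremal_coeff (κ : ℂ) (c n : ℕ) (hn : ∀ k < n, κ + 2 * c - 2 - k ≠ 0) :
    ∑ s ∈ Finset.range (n + 1), ((4 : ℂ) ^ s * (s.factorial : ℂ))⁻¹ *
        (rising (2 - κ - 2 * c) s)⁻¹ * lowerCoeff κ c s =
      ∏ k ∈ Finset.range n,
        (((c : ℂ) - 1 - k) * (κ + c - 2 - k) / ((k + 1) * (2 - κ - 2 * c + k))) := by
  have hterm : ∀ s : ℕ, ((4 : ℂ) ^ s * (s.factorial : ℂ))⁻¹ *
      (rising (2 - κ - 2 * c) s)⁻¹ * lowerCoeff κ c s =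
      ∏ k ∈ Finset.range s,
        (((c : ℂ) - k) * (κ + c - 1 - k) / ((k + 1) * (2 - κ - 2 * c + k))) := by
    intro s
    have h4 : (4 : ℂ) ^ s = ∏ _k ∈ Finset.range s, (4 : ℂ) := by simp
    have hf : (s.factorial : ℂ) = ∏ k ∈ Finset.range s, ((k : ℂ) + 1) := by
      rw [← Finset.prod_range_add_one_eq_factorial]; push_cast; rfl
    rw [h4, hf, rising, lowerCoeff, ← Finset.prod_mul_distrib, ← Finset.prod_inv_distrib,
      ← Finset.prod_inv_distrib, ← Finset.prod_mul_distrib, ← Finset.prod_mul_distrib]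
    refine Finset.prod_congr rfl fun k _ => ?_
    have : (k : ℂ) + 1 ≠ 0 := Nat.cast_add_one_ne_zero k
    rw [div_eq_mul_inv, mul_inv, mul_inv]
    ring
  simp only [hterm]
  induction n with
  | zero => simp
  | succ n ih =>
    rw [Finset.sum_range_succ, ih fun k hk => hn k (hk.trans n.lt_succ_self)]
    have hd : (2 - κ - 2 * c + n : ℂ) ≠ 0 := by
      intro h
      exact hn n n.lt_succ_self (by linear_combination -h)
    have hn1 : (n : ℂ) + 1 ≠ 0 := Nat.cast_add_one_ne_zero n
    -- The new summand is the old closed form times one rational factor: its numerators are those of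
    -- the closed form shifted by one index. The sum then telescopes, as adding `1` to that factor
    -- gives the next factor of the closed form.
    have hshift : ∏ k ∈ Finset.range (n + 1),
        (((c : ℂ) - k) * (κ + c - 1 - k) / ((k + 1) * (2 - κ - 2 * c + k))) =
        (∏ k ∈ Finset.range n,
          (((c : ℂ) - 1 - k) * (κ + c - 2 - k) / ((k + 1) * (2 - κ - 2 * c + k)))) *
          ((c : ℂ) * (κ + c - 1) / ((n + 1) * (2 - κ - 2 * c + n))) := by
      rw [Finset.prod_div_distrib, Finset.prod_div_distrib, Finset.prod_range_succ',
        Finset.prod_range_succ, div_mul_div_comm]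
      congr 1
      rw [Nat.cast_zero, sub_zero, sub_zero]
      congr 1
      refine Finset.prod_congr rfl fun k _ => ?_
      push_cast
      ring
    rw [hshift, Finset.prod_range_succ, ← mul_one_add]
    congr 1
    rw [eq_div_iff (mul_ne_zero hn1 hd), add_mul, div_mul_cancel₀ _ (mul_ne_zero hn1 hd)]
    ring

/-- The factor picked up when `N^a h` is lowered all the way to `h`. The normalisation of `projJK`
is its inverse. -/
theorem lowerCoeff_self {κ : ℂ} (hκ : 0 < κ.re) (a : ℕ) :
    lowerCoeff κ a a =
      (4 : ℂ) ^ a * (a.factorial : ℂ) * (Complex.Gamma (κ + a) / Complex.Gamma κ) := by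
  have hg := Complex.Gamma_ne_zero_of_re_pos hκ
  induction a with
  | zero => simp [lowerCoeff, hg]
  | succ a ih =>
    have h1 : lowerCoeff κ (a + 1) (a + 1) = lowerCoeff κ a a * (4 * (a + 1) * (κ + a)) := by
      rw [lowerCoeff, Finset.prod_range_succ', lowerCoeff]
      congr 1
      · refine Finset.prod_congr rfl fun k _ => ?_
        push_cast; ring
      · push_cast; ring
    have h2 : Complex.Gamma (κ + (a + 1 : ℕ)) = (κ + a) * Complex.Gamma (κ + a) := by
      rw [Nat.cast_add_one, ← add_assoc]
      refine Complex.Gamma_add_one _ fun h => ?_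
      have := congrArg Complex.re h
      simp only [Complex.add_re, Complex.natCast_re, Complex.zero_re] at this
      have : (0 : ℝ) ≤ a := a.cast_nonneg
      linarith
    rw [h1, ih, h2, Nat.factorial_succ, pow_succ]
    push_cast
    ring

end Abstract

/-! ## Fischer decomposition of polynomials in two vector variables -/

/-- Polynomials of bidegree `(p, q)` that are harmonic in `x` and in `u`. -/
structure DoubleHarmonic (p q : ℂ) (P : Poly m) : Prop extends Bihom p q P where
  lapX_eq : lapX P = 0
  lapU_eq : lapU P = 0

theorem Bihom.sqX_pow {p q : ℂ} {P : Poly m} (h : Bihom p q P) (c : ℕ) :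
    Bihom (p + 2 * c) q ((sqX ^ c) P) := by
  induction c with
  | zero => simpa using h
  | succ c ih =>
    rw [pow_succ', Module.End.mul_apply, sqX_apply]
    exact (Bihom.normSqX.mul ih).congr_deg (by push_cast; ring) (by ring)

theorem Bihom.sqU_pow {p q : ℂ} {P : Poly m} (h : Bihom p q P) (c : ℕ) :
    Bihom p (q + 2 * c) ((sqU ^ c) P) := by
  induction c with
  | zero => simpa using h
  | succ c ih =>
    rw [pow_succ', Module.End.mul_apply, sqU_apply]
    exact (Bihom.normSqU.mul ih).congr_deg (by ring) (by push_cast; ring)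

/-- The `sl₂` computation: each passage of `Δ_x` through `|x|²` costs `4𝔼_x + 2m`, evaluated at the
current degree. It is the hypothesis of the abstract lemmas with `κ = p + m/2`. -/
theorem lapX_sqX_pow {p q : ℂ} {P : Poly m} (h : Bihom p q P) (hP : lapX P = 0) (c : ℕ) :
    lapX ((sqX ^ c) P) = (4 * (c : ℂ) * (p + m / 2 + c - 1)) • (sqX ^ (c - 1)) P := by
  induction c with
  | zero => simp [hP]
  | succ c ih =>
    rw [pow_succ', Module.End.mul_apply, sqX_apply, lapX_normSqX_mul, ih, (h.sqX_pow c).x,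
      Nat.add_sub_cancel, mul_smul_comm, smul_smul, ← sqX_apply]
    rcases c with _ | c
    · simp only [pow_zero, Module.End.one_apply, CharP.cast_eq_zero]
      module
    · rw [Nat.add_sub_cancel, ← Module.End.mul_apply, ← pow_succ', ← add_smul, ← add_smul]
      congr 1
      push_cast
      ring

theorem lapU_sqU_pow {p q : ℂ} {P : Poly m} (h : Bihom p q P) (hP : lapU P = 0) (c : ℕ) :
    lapU ((sqU ^ c) P) = (4 * (c : ℂ) * (q + m / 2 + c - 1)) • (sqU ^ (c - 1)) P := by
  induction c with
  | zero => simp [hP]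
  | succ c ih =>
    rw [pow_succ', Module.End.mul_apply, sqU_apply, lapU_normSqU_mul, ih, (h.sqU_pow c).u,
      Nat.add_sub_cancel, mul_smul_comm, smul_smul, ← sqU_apply]
    rcases c with _ | c
    · simp only [pow_zero, Module.End.one_apply, CharP.cast_eq_zero]
      module
    · rw [Nat.add_sub_cancel, ← Module.End.mul_apply, ← pow_succ', ← add_smul, ← add_smul]
      congr 1
      push_cast
      ring

theorem commute_sqX_sqU : Commute (sqX : Module.End ℂ (Poly m)) sqU :=
  LinearMap.ext fun P => by
    simp only [Module.End.mul_apply, sqX_apply, sqU_apply]; ring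

theorem commute_lapX_sqU : Commute (lapX : Module.End ℂ (Poly m)) sqU :=
  LinearMap.ext fun P => by
    simp only [Module.End.mul_apply, sqU_apply, lapX_normSqU_mul]

theorem commute_lapU_sqX : Commute (lapU : Module.End ℂ (Poly m)) sqX :=
  LinearMap.ext fun P => by
    simp only [Module.End.mul_apply, sqX_apply, lapU_normSqX_mul]

theorem commute_apply {R M : Type*} [Semiring R] [AddCommMonoid M] [Module R M]
    {f g : Module.End R M} (h : Commute f g) (v : M) : f (g v) = g (f v) :=
  LinearMap.congr_fun h.eq v

theorem lapX_sqU_pow {P : Poly m} (h : lapX P = 0) (c : ℕ) : lapX ((sqU ^ c) P) = 0 := by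
  rw [commute_apply (commute_lapX_sqU.pow_right c), h, map_zero]

theorem lapU_sqX_pow {P : Poly m} (h : lapU P = 0) (c : ℕ) : lapU ((sqX ^ c) P) = 0 := by
  rw [commute_apply (commute_lapU_sqX.pow_right c), h, map_zero]

theorem natCast_ne_neg_of_pos {n k : ℕ} (hk : 0 < k) (z : ℂ) (hz : z + k = 0) : (n : ℂ) ≠ z := by
  rintro rfl
  have : n + k = 0 := by exact_mod_cast hz
  omega

theorem fischerCoeff_ne_zero (hm : 0 < m) (n a : ℕ) :
    (4 * ((a + 1 : ℕ) : ℂ) * (n + m / 2 + (a + 1 : ℕ) - 1)) ≠ 0 := by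
  refine mul_ne_zero (mul_ne_zero (by norm_num) (Nat.cast_ne_zero.2 a.succ_ne_zero)) fun h => ?_
  have h2 : ((2 * n + m + 2 * a : ℕ) : ℂ) = 0 := by
    push_cast at h ⊢
    linear_combination 2 * h
  have := Nat.cast_eq_zero.1 h2
  omega

/-- The polynomials of bidegree `(p, q)`. -/
def bihomSubmodule (m : ℕ) (p q : ℂ) : Submodule ℂ (Poly m) where
  carrier := {K | Bihom p q K}
  add_mem' h h' := Bihom.add h h'
  zero_mem' := .zero
  smul_mem' c _ h := Bihom.smul c h

theorem mem_bihomSubmodule {p q : ℂ} {P : Poly m} : P ∈ bihomSubmodule m p q ↔ Bihom p q P :=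
  Iff.rfl

theorem lapX_mem_and_eq_zero {q : ℂ} :
    (∀ n : ℕ, ∀ v ∈ bihomSubmodule m ((n + 2 : ℕ) : ℂ) q, lapX v ∈ bihomSubmodule m n q) ∧
      (∀ v ∈ bihomSubmodule m ((0 : ℕ) : ℂ) q, lapX v = 0) ∧
      ∀ v ∈ bihomSubmodule m ((1 : ℕ) : ℂ) q, lapX v = 0 := by
  refine ⟨fun n v hv => ?_, fun v hv => ?_, fun v hv => ?_⟩ <;> rw [mem_bihomSubmodule] at hv
  · exact hv.lapX.congr_deg (by push_cast; ring) rfl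
  · exact hv.lapX.eq_zero_of_x fun n =>
      natCast_ne_neg_of_pos (k := 2) two_pos _ (by push_cast; ring)
  · exact hv.lapX.eq_zero_of_x fun n =>
      natCast_ne_neg_of_pos (k := 1) one_pos _ (by push_cast; ring)

theorem lapU_mem_and_eq_zero {p : ℂ} :
    (∀ n : ℕ, ∀ v ∈ bihomSubmodule m p ((n + 2 : ℕ) : ℂ), lapU v ∈ bihomSubmodule m p n) ∧
      (∀ v ∈ bihomSubmodule m p ((0 : ℕ) : ℂ), lapU v = 0) ∧
      ∀ v ∈ bihomSubmodule m p ((1 : ℕ) : ℂ), lapU v = 0 := by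
  refine ⟨fun n v hv => ?_, fun v hv => ?_, fun v hv => ?_⟩ <;> rw [mem_bihomSubmodule] at hv
  · exact hv.lapU.congr_deg rfl (by push_cast; ring)
  · exact hv.lapU.eq_zero_of_u fun n =>
      natCast_ne_neg_of_pos (k := 2) two_pos _ (by push_cast; ring)
  · exact hv.lapU.eq_zero_of_u fun n =>
      natCast_ne_neg_of_pos (k := 1) one_pos _ (by push_cast; ring)

theorem fischer_x (hm : 0 < m) {q : ℂ} {S : Submodule ℂ (Poly m)}
    (hS : ∀ (p : ℕ) (K : Poly m), Bihom p q K → lapX K = 0 → ∀ a : ℕ, (sqX ^ a) K ∈ S) (p : ℕ) :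
    bihomSubmodule m p q ≤ S := by
  refine fischer_span (L := lapX) (N := sqX) (W := fun p : ℕ => bihomSubmodule m p q)
    (c := fun n a => 4 * ((a + 1 : ℕ) : ℂ) * (n + m / 2 + (a + 1 : ℕ) - 1))
    (fun n v hv => ?_) lapX_mem_and_eq_zero.1 lapX_mem_and_eq_zero.2.1 lapX_mem_and_eq_zero.2.2
    (fischerCoeff_ne_zero hm) (fun n h hh hL a => ?_) hS p
  · rw [mem_bihomSubmodule] at hv ⊢
    rw [← pow_one sqX]
    exact (hv.sqX_pow 1).congr_deg (by push_cast; ring) rfl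
  · rw [mem_bihomSubmodule] at hh
    rw [lapX_sqX_pow hh hL (a + 1), Nat.add_sub_cancel]

/-- The polynomials of bidegree `(p, q)` that are harmonic in `x`. -/
def harmonicXSubmodule (m : ℕ) (p q : ℂ) : Submodule ℂ (Poly m) where
  carrier := {K | Bihom p q K ∧ lapX K = 0}
  add_mem' h h' := ⟨h.1.add h'.1, by rw [map_add, h.2, h'.2, add_zero]⟩
  zero_mem' := ⟨.zero, map_zero _⟩
  smul_mem' c _ h := ⟨h.1.smul c, by rw [map_smul, h.2, smul_zero]⟩

theorem mem_harmonicXSubmodule {p q : ℂ} {P : Poly m} :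
    P ∈ harmonicXSubmodule m p q ↔ Bihom p q P ∧ lapX P = 0 :=
  Iff.rfl

/-- The kernel of `Δ_x` is stable under `|u|²` and `Δ_u`, so the decomposition in `u` can be carried
out inside it and its components are double harmonic. -/
theorem fischer_u (hm : 0 < m) {p : ℂ} {S : Submodule ℂ (Poly m)}
    (hS : ∀ (q : ℕ) (H : Poly m), DoubleHarmonic p q H → ∀ b : ℕ, (sqU ^ b) H ∈ S) (q : ℕ) :
    harmonicXSubmodule m p q ≤ S := by
  refine fischer_span (L := lapU) (N := sqU) (W := fun q : ℕ => harmonicXSubmodule m p q)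
    (c := fun n a => 4 * ((a + 1 : ℕ) : ℂ) * (n + m / 2 + (a + 1 : ℕ) - 1))
    (fun n v hv => ?_) (fun n v hv => ?_) (fun v hv => ?_) (fun v hv => ?_)
    (fischerCoeff_ne_zero hm) (fun n h hh hL a => ?_) (fun q h hh hL b => ?_) q
  · rw [mem_harmonicXSubmodule] at hv ⊢
    have h1 := hv.1.sqU_pow 1
    have h2 := lapX_sqU_pow hv.2 1
    rw [pow_one] at h1 h2
    exact ⟨h1.congr_deg rfl (by push_cast; ring), h2⟩
  · rw [mem_harmonicXSubmodule] at hv ⊢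
    exact ⟨lapU_mem_and_eq_zero.1 n v (mem_bihomSubmodule.2 hv.1), by
      rw [lapX_lapU, hv.2, map_zero]⟩
  · rw [mem_harmonicXSubmodule] at hv
    exact lapU_mem_and_eq_zero.2.1 v (mem_bihomSubmodule.2 hv.1)
  · rw [mem_harmonicXSubmodule] at hv
    exact lapU_mem_and_eq_zero.2.2 v (mem_bihomSubmodule.2 hv.1)
  · rw [mem_harmonicXSubmodule] at hh
    rw [lapU_sqU_pow hh.1 hL (a + 1), Nat.add_sub_cancel]
  · rw [mem_harmonicXSubmodule] at hh
    exact hS q h ⟨hh.1, hh.2, hL⟩ b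

/-- Every polynomial is a sum of polynomials `|x|^{2a} |u|^{2b} H` with `H` double harmonic. -/
theorem fischer_decomposition (hm : 0 < m) {S : Submodule ℂ (Poly m)}
    (hS : ∀ (p q : ℕ) (H : Poly m), DoubleHarmonic p q H →
      ∀ a b : ℕ, (sqX ^ a) ((sqU ^ b) H) ∈ S) (P : Poly m) : P ∈ S := by
  rw [P.as_sum]
  refine sum_mem fun s _ => ?_
  refine fischer_x (q := degU s) hm (fun p K hK hL a => ?_) (degX s)
    (mem_bihomSubmodule.2 (Bihom.monomial s _))
  -- Pulling `S` back along `|x|^{2a}` leaves only the harmonic factor `K` to be decomposed in `u`.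
  refine Submodule.mem_comap.1 (fischer_u (S := S.comap (sqX ^ a)) hm (fun q H hH b => ?_)
    (degU s) (mem_harmonicXSubmodule.2 ⟨hK, hL⟩))
  rw [Submodule.mem_comap]
  exact hS p q H hH a b

/-! ## The projection operators on the Fischer decomposition -/

/-- For `c > 0` the closed form of `sum_extremal_coeff` contains the zero factor `k = c - 1`; for `c
= 0` only the term `j = 0` survives. This is why the extremal projector kills multiples of `|x|²`.
-/
theorem extremal_sum_eq (hm : 2 < m) (p c : ℕ) :
    ∑ j ∈ Finset.range (p + 2 * c + 1), ((4 : ℂ) ^ j * (j.factorial : ℂ))⁻¹ *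
      (rising (-(((p + 2 * c : ℕ) : ℂ) + (m : ℂ) / 2) + 2) j)⁻¹ *
        lowerCoeff ((p : ℂ) + m / 2) c j = if c = 0 then 1 else 0 := by
  have hr : -(((p + 2 * c : ℕ) : ℂ) + (m : ℂ) / 2) + 2 = 2 - ((p : ℂ) + m / 2) - 2 * c := by
    push_cast; ring
  rw [hr]
  split_ifs with hc
  · rw [Finset.sum_eq_single 0]
    · simp [rising, lowerCoeff]
    · intro j _ hj
      rw [lowerCoeff_eq_zero _ (by omega), mul_zero]
    · simp
  · rw [sum_extremal_coeff]
    · refine Finset.prod_eq_zero (i := c - 1) (Finset.mem_range.2 (by omega)) ?_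
      rw [Nat.cast_sub (by omega)]
      simp
    -- A zero denominator would force `2p + m + 4c = 4 + 2k` with `k < p + 2c`, impossible for `m >
    -- 2`.
    · intro k hk h
      have h2 : ((2 * p + m + 4 * c : ℕ) : ℂ) = ((4 + 2 * k : ℕ) : ℂ) := by
        push_cast
        linear_combination 2 * h
      have := Nat.cast_injective h2
      omega

theorem piX_sqX_pow (hm : 2 < m) {p : ℕ} {q : ℂ} {P : Poly m} (h : Bihom p q P)
    (hP : lapX P = 0) (c : ℕ) : piX ((sqX ^ c) P) = if c = 0 then P else 0 := by
  have hB : Bihom ((p + 2 * c : ℕ) : ℂ) q ((sqX ^ c) P) :=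
    (h.sqX_pow c).congr_deg (by push_cast; ring) rfl
  have hterm : ∀ j, extremalTermX j ((sqX ^ c) P) = (((4 : ℂ) ^ j * (j.factorial : ℂ))⁻¹ *
      (rising (-(((p + 2 * c : ℕ) : ℂ) + (m : ℂ) / 2) + 2) j)⁻¹ *
        lowerCoeff ((p : ℂ) + m / 2) c j) • (sqX ^ c) P := by
    intro j
    rw [extremalTermX, LinearMap.smul_apply, Module.End.mul_apply, Module.End.mul_apply,
      pow_raise_pow_lower_apply (lapX_sqX_pow h hP), map_smul, funEulerX_apply _ hB, smul_smul,
      smul_smul]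
    congr 1
    ring
  rw [piX_apply hB]
  simp only [hterm]
  rw [← Finset.sum_smul, extremal_sum_eq hm]
  split_ifs with hc
  · rw [hc, pow_zero, Module.End.one_apply, one_smul]
  · rw [zero_smul]

theorem piU_sqU_pow (hm : 2 < m) {p : ℂ} {q : ℕ} {P : Poly m} (h : Bihom p q P)
    (hP : lapU P = 0) (c : ℕ) : piU ((sqU ^ c) P) = if c = 0 then P else 0 := by
  have hB : Bihom p ((q + 2 * c : ℕ) : ℂ) ((sqU ^ c) P) :=
    (h.sqU_pow c).congr_deg rfl (by push_cast; ring)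
  have hterm : ∀ j, extremalTermU j ((sqU ^ c) P) = (((4 : ℂ) ^ j * (j.factorial : ℂ))⁻¹ *
      (rising (-(((q + 2 * c : ℕ) : ℂ) + (m : ℂ) / 2) + 2) j)⁻¹ *
        lowerCoeff ((q : ℂ) + m / 2) c j) • (sqU ^ c) P := by
    intro j
    rw [extremalTermU, LinearMap.smul_apply, Module.End.mul_apply, Module.End.mul_apply,
      pow_raise_pow_lower_apply (lapU_sqU_pow h hP), map_smul, funEulerU_apply _ hB, smul_smul,
      smul_smul]
    congr 1
    ring
  rw [piU_apply hB]
  simp only [hterm]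
  rw [← Finset.sum_smul, extremal_sum_eq hm]
  split_ifs with hc
  · rw [hc, pow_zero, Module.End.one_apply, one_smul]
  · rw [zero_smul]

theorem piS_sqX_pow_sqU_pow (hm : 2 < m) {p q : ℕ} {H : Poly m} (h : DoubleHarmonic p q H)
    (a b : ℕ) : piS ((sqX ^ a) ((sqU ^ b) H)) = if a = 0 ∧ b = 0 then H else 0 := by
  rw [piS, Module.End.mul_apply, commute_apply (commute_sqX_sqU.pow_pow a b),
    piU_sqU_pow hm (h.sqX_pow a) (lapU_sqX_pow h.lapU_eq a)]
  by_cases hb : b = 0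
  · rw [if_pos hb, piX_sqX_pow hm h.toBihom h.lapX_eq]
    simp [hb]
  · simp [hb]

theorem DoubleHarmonic.piS_eq (hm : 2 < m) {p q : ℂ} {H : Poly m} (h : DoubleHarmonic p q H) :
    piS H = H := by
  by_cases hp : ∃ n : ℕ, (n : ℂ) = p
  · by_cases hq : ∃ n : ℕ, (n : ℂ) = q
    · obtain ⟨p, rfl⟩ := hp
      obtain ⟨q, rfl⟩ := hq
      simpa using piS_sqX_pow_sqU_pow hm h 0 0
    · rw [h.eq_zero_of_u (not_exists.1 hq), map_zero]
  · rw [h.eq_zero_of_x (not_exists.1 hp), map_zero]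

theorem DoubleHarmonic.dUdX {p q : ℂ} {H : Poly m} (h : DoubleHarmonic p q H) :
    DoubleHarmonic (p - 1) (q - 1) (dUdX H) :=
  ⟨h.toBihom.dUdX, by rw [lapX_dUdX, h.lapX_eq, map_zero], by rw [lapU_dUdX, h.lapU_eq, map_zero]⟩

/-- `⟨∂_u,∂_x⟩` commutes with both Laplacians, so it preserves double harmonics, on which `π_𝔰` is
the identity. -/
theorem DoubleHarmonic.opA_pow (hm : 2 < m) {p q : ℂ} {H : Poly m} (h : DoubleHarmonic p q H)
    (n : ℕ) : (opA ^ n) H = (StiefelPizzetti.dUdX ^ n) H := by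
  induction n generalizing p q H with
  | zero => rfl
  | succ n ih =>
    rw [pow_succ, Module.End.mul_apply, opA, Module.End.mul_apply, h.dUdX.piS_eq hm, ← opA,
      ih h.dUdX, pow_succ, Module.End.mul_apply]

/-- `Δ_x^j Δ_u^k` lowers the exponents to `a - j` and `b - k`, `π_𝔰` removes whatever still carries
a square, and the Gamma quotients cancel the factor `lowerCoeff_self`. -/
theorem projJK_apply (hm : 2 < m) {p q : ℕ} {H : Poly m} (h : DoubleHarmonic p q H)
    (a b j k : ℕ) :
    projJK j k ((sqX ^ a) ((sqU ^ b) H)) = if a = j ∧ b = k then H else 0 := by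
  have hκ : ∀ n : ℕ, 0 < ((n : ℂ) + m / 2).re := by
    intro n
    have h1 : ((n : ℂ) + m / 2).re = n + m / 2 := by
      rw [Complex.add_re, Complex.natCast_re, Complex.div_ofNat_re, Complex.natCast_re]
    rw [h1]
    have : (0 : ℝ) < m := by exact_mod_cast (by omega : 0 < m)
    positivity
  have hΓ : ∀ n l : ℕ, Complex.Gamma ((n : ℂ) + m / 2 + l) ≠ 0 := by
    intro n l
    refine Complex.Gamma_ne_zero_of_re_pos ?_
    rw [Complex.add_re, Complex.natCast_re]
    have := hκ n
    positivity
  rw [projJK]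
  simp only [LinearMap.smul_apply, Module.End.mul_apply]
  rw [commute_apply ((commute_lapU_sqX.pow_pow k a)),
    pow_lower_apply (lapU_sqU_pow h.toBihom h.lapU_eq), map_smul, map_smul,
    pow_lower_apply (lapX_sqX_pow (h.sqU_pow _) (lapX_sqU_pow h.lapX_eq _))]
  simp only [map_smul]
  rw [piS_sqX_pow_sqU_pow hm h]
  by_cases hjk : a = j ∧ b = k
  · obtain ⟨rfl, rfl⟩ := hjk
    rw [if_pos ⟨Nat.sub_self _, Nat.sub_self _⟩, if_pos ⟨rfl, rfl⟩]
    simp only [map_smul, funEulerU_apply _ h.toBihom, funEulerX_apply _ h.toBihom, smul_smul]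
    rw [lowerCoeff_self (hκ p), lowerCoeff_self (hκ q)]
    convert one_smul ℂ H
    have h1 := hΓ p a
    have h2 := hΓ q b
    have h3 := Complex.Gamma_ne_zero_of_re_pos (hκ p)
    have h4 := Complex.Gamma_ne_zero_of_re_pos (hκ q)
    have h5 : (a.factorial : ℂ) ≠ 0 := Nat.cast_ne_zero.2 a.factorial_ne_zero
    have h6 : (b.factorial : ℂ) ≠ 0 := Nat.cast_ne_zero.2 b.factorial_ne_zero
    generalize Complex.Gamma ((p : ℂ) + m / 2 + a) = g1 at h1 ⊢
    generalize Complex.Gamma ((q : ℂ) + m / 2 + b) = g2 at h2 ⊢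
    generalize Complex.Gamma ((p : ℂ) + m / 2) = g3 at h3 ⊢
    generalize Complex.Gamma ((q : ℂ) + m / 2) = g4 at h4 ⊢
    rw [pow_add]
    field_simp
  · rw [if_neg hjk]
    -- Truncated subtraction also gives `a - j = 0` when `a < j`; there the scalar from lowering
    -- vanishes instead.
    by_cases hj : a < j
    · rw [lowerCoeff_eq_zero _ hj]
      simp
    by_cases hk : b < k
    · rw [lowerCoeff_eq_zero _ hk]
      simp
    rw [if_neg (by omega)]
    simp

/-! ## Powers of `⟨∂_u, ∂_x⟩` evaluated at the origin -/

/-- Evaluation at the origin. -/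
def evalZero : Poly m →ₗ[ℂ] ℂ := lcoeff ℂ 0

theorem evalZero_apply (P : Poly m) : evalZero P = constantCoeff P := rfl

theorem evalAt_zero (P : Poly m) : evalAt P 0 0 = evalZero P := by
  rw [evalAt, evalZero_apply, ← eval_zero]
  congr 2
  ext i
  rcases i with i | i <;> simp

theorem evalZero_X_mul (i : Fin m ⊕ Fin m) (P : Poly m) : evalZero (X i * P) = 0 := by
  simp [evalZero_apply]

theorem evalZero_normSqX_mul (P : Poly m) : evalZero (normSqX * P) = 0 := by
  simp [evalZero_apply, normSqX]

theorem evalZero_normSqU_mul (P : Poly m) : evalZero (normSqU * P) = 0 := by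
  simp [evalZero_apply, normSqU]

theorem evalZero_innerXU_mul (P : Poly m) : evalZero (innerXU * P) = 0 := by
  simp [evalZero_apply, innerXU]

theorem evalZero_opE (P : Poly m) : evalZero (opE P) = 0 := by
  simp [opE_apply, evalZero_X_mul]

theorem evalZero_opF (P : Poly m) : evalZero (opF P) = 0 := by
  simp [opF_apply, evalZero_X_mul]

theorem commute_lapX_dUdX : Commute (lapX : Module.End ℂ (Poly m)) dUdX :=
  LinearMap.ext fun P => lapX_dUdX P

theorem commute_lapU_dUdX : Commute (lapU : Module.End ℂ (Poly m)) dUdX :=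
  LinearMap.ext fun P => lapU_dUdX P

/-- With `D = ⟨∂_u,∂_x⟩`, the iterated commutators `[D,|x|²] = 2 opE`, `[D,opE] = Δ_u`, `[D,Δ_u] =
0` stop after three terms, so this is a binomial expansion. -/
theorem dUdX_pow_normSqX_mul (n : ℕ) (P : Poly m) :
    (dUdX ^ (n + 2)) (normSqX * P) = normSqX * (dUdX ^ (n + 2)) P +
      (2 * (n + 2) : ℂ) • opE ((dUdX ^ (n + 1)) P) +
      ((n + 2) * (n + 1) : ℂ) • lapU ((dUdX ^ n) P) := by
  induction n with
  | zero =>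
    simp only [zero_add, pow_succ, pow_zero, one_mul, Module.End.mul_apply, dUdX_normSqX_mul,
      map_add, map_smul, dUdX_opE, Nat.cast_zero, Module.End.one_apply]
    module
  | succ n ih =>
    rw [show n + 1 + 2 = (n + 2) + 1 by ring, pow_succ', Module.End.mul_apply, ih]
    simp only [map_add, map_smul, dUdX_normSqX_mul, dUdX_opE, ← lapU_dUdX]
    simp only [pow_succ', Module.End.mul_apply, Nat.cast_succ]
    module

theorem dUdX_pow_normSqU_mul (n : ℕ) (P : Poly m) :
    (dUdX ^ (n + 2)) (normSqU * P) = normSqU * (dUdX ^ (n + 2)) P +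
      (2 * (n + 2) : ℂ) • opF ((dUdX ^ (n + 1)) P) +
      ((n + 2) * (n + 1) : ℂ) • lapX ((dUdX ^ n) P) := by
  induction n with
  | zero =>
    simp only [zero_add, pow_succ, pow_zero, one_mul, Module.End.mul_apply, dUdX_normSqU_mul,
      map_add, map_smul, dUdX_opF, Nat.cast_zero, Module.End.one_apply]
    module
  | succ n ih =>
    rw [show n + 1 + 2 = (n + 2) + 1 by ring, pow_succ', Module.End.mul_apply, ih]
    simp only [map_add, map_smul, dUdX_normSqU_mul, dUdX_opF, ← lapX_dUdX]
    simp only [pow_succ', Module.End.mul_apply, Nat.cast_succ]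
    module

theorem dUdX_pow_opE (n : ℕ) (P : Poly m) :
    (dUdX ^ (n + 1)) (opE P) = opE ((dUdX ^ (n + 1)) P) + (n + 1 : ℂ) • lapU ((dUdX ^ n) P) := by
  induction n with
  | zero => simp [dUdX_opE]
  | succ n ih =>
    rw [pow_succ', Module.End.mul_apply, ih]
    simp only [map_add, map_smul, dUdX_opE, ← lapU_dUdX]
    simp only [pow_succ', Module.End.mul_apply, Nat.cast_succ]
    module

theorem dUdX_pow_opF (n : ℕ) (P : Poly m) :
    (dUdX ^ (n + 1)) (opF P) = opF ((dUdX ^ (n + 1)) P) + (n + 1 : ℂ) • lapX ((dUdX ^ n) P) := by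
  induction n with
  | zero => simp [dUdX_opF]
  | succ n ih =>
    rw [pow_succ', Module.End.mul_apply, ih]
    simp only [map_add, map_smul, dUdX_opF, ← lapX_dUdX]
    simp only [pow_succ', Module.End.mul_apply, Nat.cast_succ]
    module

theorem Bihom.dUdX_pow {p q : ℂ} {P : Poly m} (h : Bihom p q P) (n : ℕ) :
    Bihom (p - n) (q - n) ((StiefelPizzetti.dUdX ^ n) P) := by
  induction n with
  | zero => simpa using h
  | succ n ih =>
    rw [pow_succ', Module.End.mul_apply]
    exact ih.dUdX.congr_deg (by push_cast; ring) (by push_cast; ring)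

/-- The scalar is `∑_{k ≤ n} (p + q + m - 2k)`: one commutator for each factor of `D`, evaluated at
the bidegree already lowered `k` times. -/
theorem dUdX_pow_innerXU_mul {p q : ℂ} {P : Poly m} (h : Bihom p q P) (n : ℕ) :
    (dUdX ^ (n + 1)) (innerXU * P) = innerXU * (dUdX ^ (n + 1)) P +
      ((n + 1) * (p + q + m - n) : ℂ) • (dUdX ^ n) P := by
  induction n with
  | zero =>
    rw [zero_add, pow_one, dUdX_innerXU_mul, h.x, h.u, pow_zero, Module.End.one_apply,
      Nat.cast_zero]
    module
  | succ n ih =>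
    have hB := h.dUdX_pow (n + 1)
    rw [pow_succ', Module.End.mul_apply, ih, map_add, map_smul, dUdX_innerXU_mul, hB.x, hB.u]
    simp only [pow_succ', Module.End.mul_apply, Nat.cast_succ]
    module

/-- Of the three terms of the expansion, two carry a factor vanishing at the origin and the third
contains `Δ_u P`. -/
theorem evalZero_dUdX_pow_normSqX_mul {P : Poly m} (h : lapU P = 0) (n : ℕ) :
    evalZero ((dUdX ^ n) (normSqX * P)) = 0 := by
  rcases n with _ | _ | n
  · exact evalZero_normSqX_mul P
  · rw [zero_add, pow_one, dUdX_normSqX_mul, map_add, map_smul, evalZero_normSqX_mul, evalZero_opE]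
    simp
  · rw [dUdX_pow_normSqX_mul, commute_apply (commute_lapU_dUdX.pow_right n), h]
    simp [evalZero_normSqX_mul, evalZero_opE]

theorem evalZero_dUdX_pow_normSqU_mul {P : Poly m} (h : lapX P = 0) (n : ℕ) :
    evalZero ((dUdX ^ n) (normSqU * P)) = 0 := by
  rcases n with _ | _ | n
  · exact evalZero_normSqU_mul P
  · rw [zero_add, pow_one, dUdX_normSqU_mul, map_add, map_smul, evalZero_normSqU_mul, evalZero_opF]
    simp
  · rw [dUdX_pow_normSqU_mul, commute_apply (commute_lapX_dUdX.pow_right n), h]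
    simp [evalZero_normSqU_mul, evalZero_opF]

theorem evalZero_dUdX_pow_opE {P : Poly m} (h : lapU P = 0) (n : ℕ) :
    evalZero ((dUdX ^ n) (opE P)) = 0 := by
  rcases n with _ | n
  · exact evalZero_opE P
  · rw [dUdX_pow_opE, commute_apply (commute_lapU_dUdX.pow_right n), h]
    simp [evalZero_opE]

theorem evalZero_dUdX_pow_opF {P : Poly m} (h : lapX P = 0) (n : ℕ) :
    evalZero ((dUdX ^ n) (opF P)) = 0 := by
  rcases n with _ | n
  · exact evalZero_opF P
  · rw [dUdX_pow_opF, commute_apply (commute_lapX_dUdX.pow_right n), h]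
    simp [evalZero_opF]

theorem Bihom.evalZero_dUdX_pow {p q : ℂ} {P : Poly m} (h : Bihom p q P) {n : ℕ}
    (hn : p ≠ n ∨ q ≠ n) : evalZero ((StiefelPizzetti.dUdX ^ n) P) = 0 :=
  (h.dUdX_pow n).coeff_zero (hn.imp sub_ne_zero.2 sub_ne_zero.2)

/-! ## The infinitesimal rotations -/

/-- The infinitesimal rotation `x_a ∂_{x_b} - x_b ∂_{x_a} + u_a ∂_{u_b} - u_b ∂_{u_a}`. -/
def opRot (a b : Fin m) : Module.End ℂ (Poly m) :=
  mX a * dX b - mX b * dX a + mU a * dU b - mU b * dU a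

theorem opRot_apply (a b : Fin m) (P : Poly m) :
    opRot a b P = X (Sum.inl a) * dX b P - X (Sum.inl b) * dX a P + X (Sum.inr a) * dU b P -
      X (Sum.inr b) * dU a P := by
  simp [opRot, mX, mU]

theorem opRot_mul (a b : Fin m) (P Q : Poly m) :
    opRot a b (P * Q) = opRot a b P * Q + P * opRot a b Q := by
  simp only [opRot_apply, dX_mul, dU_mul]
  ring

theorem opRot_normSqX (a b : Fin m) : opRot a b (normSqX : Poly m) = 0 := by
  simp only [opRot_apply, dX_normSqX, dU_normSqX]
  ring

theorem opRot_normSqU (a b : Fin m) : opRot a b (normSqU : Poly m) = 0 := by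
  simp only [opRot_apply, dX_normSqU, dU_normSqU]
  ring

theorem evalZero_opRot (a b : Fin m) (P : Poly m) : evalZero (opRot a b P) = 0 := by
  simp [opRot_apply, evalZero_X_mul]

theorem lapX_opRot (a b : Fin m) (P : Poly m) : lapX (opRot a b P) = opRot a b (lapX P) := by
  simp only [opRot_apply, map_add, map_sub, lapX_X_inl_mul, lapX_X_inr_mul, lapX_dX, lapX_dU,
    dX_dX a b]
  ring

theorem lapU_opRot (a b : Fin m) (P : Poly m) : lapU (opRot a b P) = opRot a b (lapU P) := by
  simp only [opRot_apply, map_add, map_sub, lapU_X_inl_mul, lapU_X_inr_mul, lapU_dX, lapU_dU,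
    dU_dU a b]
  ring

theorem dUdX_opRot (a b : Fin m) (P : Poly m) : dUdX (opRot a b P) = opRot a b (dUdX P) := by
  simp only [opRot_apply, map_add, map_sub, dUdX_X_inl_mul, dUdX_X_inr_mul, dUdX_dX, dUdX_dU,
    dX_dU]
  ring

theorem Bihom.opRot {p q : ℂ} {P : Poly m} (h : Bihom p q P) (a b : Fin m) :
    Bihom p q (opRot a b P) := by
  rw [opRot_apply]
  have hx : ∀ a b : Fin m, Bihom p q (MvPolynomial.X (Sum.inl a) * StiefelPizzetti.dX b P) :=
    fun a b => ((X_inl a).mul (h.dX b)).congr_deg (by ring) (by ring)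
  have hu : ∀ a b : Fin m, Bihom p q (MvPolynomial.X (Sum.inr a) * StiefelPizzetti.dU b P) :=
    fun a b => ((X_inr a).mul (h.dU b)).congr_deg (by ring) (by ring)
  exact (((hx a b).sub (hx b a)).add (hu a b)).sub (hu b a)

theorem DoubleHarmonic.opRot {p q : ℂ} {P : Poly m} (h : DoubleHarmonic p q P) (a b : Fin m) :
    DoubleHarmonic p q (opRot a b P) :=
  ⟨h.toBihom.opRot a b, by rw [lapX_opRot, h.lapX_eq, map_zero],
    by rw [lapU_opRot, h.lapU_eq, map_zero]⟩

/-! ## The Pizzetti functional -/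

/-- The summands of the Pizzetti formula. -/
def pizzettiTerm (n : ℕ × ℕ × ℕ) : Poly m →ₗ[ℂ] ℂ :=
  gammaCoeff m n.1 • (evalZero ∘ₗ (opA ^ (2 * n.1) * projJK n.2.1 n.2.2))

theorem pizzettiTerm_apply (n : ℕ × ℕ × ℕ) (P : Poly m) :
    pizzettiTerm n P =
      gammaCoeff m n.1 * evalZero ((opA ^ (2 * n.1)) (projJK n.2.1 n.2.2 P)) := rfl

theorem pizzettiTerm_fischer (hm : 2 < m) {p q : ℕ} {H : Poly m} (h : DoubleHarmonic p q H)
    (a b : ℕ) (n : ℕ × ℕ × ℕ) :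
    pizzettiTerm n ((sqX ^ a) ((sqU ^ b) H)) =
      if n.2 = (a, b) then gammaCoeff m n.1 * evalZero ((dUdX ^ (2 * n.1)) H) else 0 := by
  rw [pizzettiTerm_apply, projJK_apply hm h]
  by_cases hn : n.2 = (a, b)
  · rw [if_pos hn, hn, if_pos ⟨rfl, rfl⟩, h.opA_pow hm]
  · rw [if_neg hn, if_neg fun h => hn (Prod.ext h.1.symm h.2.symm)]
    simp

theorem support_pizzettiTerm_finite (hm : 2 < m) (P : Poly m) :
    (Function.support fun n => pizzettiTerm n P).Finite := by
  let S : Submodule ℂ (Poly m) :=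
    { carrier := {P | (Function.support fun n => pizzettiTerm n P).Finite}
      add_mem' := fun {P Q} hP hQ => (hP.union hQ).subset fun n hn => by
        by_contra h
        rw [Set.mem_union, not_or, Function.notMem_support, Function.notMem_support] at h
        exact hn (by simp only [map_add, h.1, h.2, add_zero])
      zero_mem' := by simp
      smul_mem' := fun c P hP => Set.Finite.subset hP fun n hn h => hn (by
        simp only [map_smul, h, smul_zero]) }
  refine fischer_decomposition (S := S) (by omega) (fun p q H h a b => ?_) P
  -- Only `(j,k) = (a,b)` contributes, and `D^{2i}H` has non-zero constant term only if `p = 2i`, so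
  -- `i ≤ p`.
  refine ((Set.finite_Iic p).image fun i => (i, a, b)).subset fun n hn => ?_
  rw [Function.mem_support, pizzettiTerm_fischer hm h] at hn
  rw [ite_ne_right_iff] at hn
  refine ⟨n.1, ?_, Prod.ext rfl hn.1.symm⟩
  by_contra hp
  rw [Set.mem_Iic, not_le] at hp
  refine hn.2 ?_
  rw [h.evalZero_dUdX_pow (Or.inl (Nat.cast_injective.ne (by omega))), mul_zero]

/-- The right-hand side of the Pizzetti formula, as a linear functional. -/
def pizzetti (hm : 2 < m) : Poly m →ₗ[ℂ] ℂ where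
  toFun P := ∑ᶠ n, pizzettiTerm n P
  map_add' P Q := by
    simp only [map_add]
    exact finsum_add_distrib (support_pizzettiTerm_finite hm P) (support_pizzettiTerm_finite hm Q)
  map_smul' c P := by
    simp only [map_smul]
    exact (smul_finsum' c (support_pizzettiTerm_finite hm P)).symm

theorem pizzetti_apply (hm : 2 < m) (P : Poly m) :
    pizzetti hm P = ∑ᶠ n, pizzettiTerm n P := rfl

/-- The bound `N` is free so that polynomials of different degrees can be summed over a common
range. The right-hand side does not involve `a` and `b`. -/
theorem pizzetti_fischer (hm : 2 < m) {p q : ℕ} {H : Poly m} (h : DoubleHarmonic p q H)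
    (a b N : ℕ) (hN : p ≤ N) :
    pizzetti hm ((sqX ^ a) ((sqU ^ b) H)) =
      ∑ i ∈ Finset.range (N + 1), gammaCoeff m i * evalZero ((dUdX ^ (2 * i)) H) := by
  rw [pizzetti_apply]
  simp only [pizzettiTerm_fischer hm h]
  have hinj : Function.Injective fun i : ℕ => ((i, a, b) : ℕ × ℕ × ℕ) :=
    fun i j hij => congrArg Prod.fst hij
  rw [finsum_eq_sum_of_support_subset (s := (Finset.range (N + 1)).map ⟨_, hinj⟩),
    Finset.sum_map]
  · exact Finset.sum_congr rfl fun i _ => if_pos rfl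
  · intro n hn
    rw [Function.mem_support, ite_ne_right_iff] at hn
    rw [Finset.coe_map]
    refine ⟨n.1, ?_, Prod.ext rfl hn.1.symm⟩
    by_contra hp
    rw [Finset.mem_coe, Finset.mem_range, not_lt] at hp
    refine hn.2 ?_
    rw [h.evalZero_dUdX_pow (Or.inl (Nat.cast_injective.ne (by omega))), mul_zero]

/-- The form used for components whose bidegree comes out of lowering operators: without natural
degrees the polynomial is zero, and "eventually" lets several components share one cut-off. -/
theorem DoubleHarmonic.eventually_pizzetti (hm : 2 < m) {p q : ℂ} {H : Poly m}
    (h : DoubleHarmonic p q H) : ∀ᶠ N in Filter.atTop, pizzetti hm H =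
      ∑ i ∈ Finset.range (N + 1),
        gammaCoeff m i * evalZero ((StiefelPizzetti.dUdX ^ (2 * i)) H) := by
  by_cases hp : ∃ n : ℕ, (n : ℂ) = p
  · by_cases hq : ∃ n : ℕ, (n : ℂ) = q
    · obtain ⟨p, rfl⟩ := hp
      obtain ⟨q, rfl⟩ := hq
      filter_upwards [Filter.eventually_ge_atTop p] with N hN
      simpa using pizzetti_fischer hm h 0 0 N hN
    · rw [h.eq_zero_of_u (not_exists.1 hq)]
      simp
  · rw [h.eq_zero_of_x (not_exists.1 hp)]
    simp

theorem fischer_ext (hm : 0 < m) {T : Poly m →ₗ[ℂ] ℂ}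
    (hT : ∀ (p q : ℕ) (H : Poly m), DoubleHarmonic p q H →
      ∀ a b : ℕ, T ((sqX ^ a) ((sqU ^ b) H)) = 0) (P : Poly m) : T P = 0 :=
  LinearMap.mem_ker.1 (fischer_decomposition (S := LinearMap.ker T) hm
    (fun p q H h a b => LinearMap.mem_ker.2 (hT p q H h a b)) P)

theorem pizzetti_normSqX_mul (hm : 2 < m) (P : Poly m) :
    pizzetti hm (normSqX * P) = pizzetti hm P := by
  have : (pizzetti hm ∘ₗ sqX - pizzetti hm) P = 0 := by
    refine fischer_ext (by omega) (fun p q H h a b => ?_) P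
    rw [LinearMap.sub_apply, LinearMap.comp_apply, ← Module.End.mul_apply sqX,
      ← pow_succ', pizzetti_fischer hm h _ _ p le_rfl, pizzetti_fischer hm h _ _ p le_rfl, sub_self]
  rw [LinearMap.sub_apply, LinearMap.comp_apply, sqX_apply] at this
  exact sub_eq_zero.1 this

theorem pizzetti_normSqU_mul (hm : 2 < m) (P : Poly m) :
    pizzetti hm (normSqU * P) = pizzetti hm P := by
  have : (pizzetti hm ∘ₗ sqU - pizzetti hm) P = 0 := by
    refine fischer_ext (by omega) (fun p q H h a b => ?_) P
    rw [LinearMap.sub_apply, LinearMap.comp_apply,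
      ← commute_apply (commute_sqX_sqU.pow_left a), ← Module.End.mul_apply sqU,
      ← pow_succ', pizzetti_fischer hm h _ _ p le_rfl, pizzetti_fischer hm h _ _ p le_rfl, sub_self]
  rw [LinearMap.sub_apply, LinearMap.comp_apply, sqU_apply] at this
  exact sub_eq_zero.1 this

theorem pizzetti_sqX_pow (hm : 2 < m) (a : ℕ) (P : Poly m) :
    pizzetti hm ((sqX ^ a) P) = pizzetti hm P := by
  induction a with
  | zero => simp
  | succ a ih => rw [pow_succ', Module.End.mul_apply, sqX_apply, pizzetti_normSqX_mul, ih]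

theorem pizzetti_sqU_pow (hm : 2 < m) (a : ℕ) (P : Poly m) :
    pizzetti hm ((sqU ^ a) P) = pizzetti hm P := by
  induction a with
  | zero => simp
  | succ a ih => rw [pow_succ', Module.End.mul_apply, sqU_apply, pizzetti_normSqU_mul, ih]

theorem commute_opRot_sqX (a b : Fin m) : Commute (opRot a b) sqX :=
  LinearMap.ext fun P => by
    simp only [Module.End.mul_apply, sqX_apply, opRot_mul, opRot_normSqX, zero_mul, zero_add]

theorem commute_opRot_sqU (a b : Fin m) : Commute (opRot a b) sqU :=
  LinearMap.ext fun P => by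
    simp only [Module.End.mul_apply, sqU_apply, opRot_mul, opRot_normSqU, zero_mul, zero_add]

theorem commute_opRot_dUdX (a b : Fin m) : Commute (opRot a b) dUdX :=
  LinearMap.ext fun P => (dUdX_opRot a b P).symm

/-- A rotation passes through the squares, the Laplacians and `D`, and its coefficients vanish at
the origin. -/
theorem pizzetti_opRot (hm : 2 < m) (a b : Fin m) (P : Poly m) :
    pizzetti hm (opRot a b P) = 0 := by
  have : (pizzetti hm ∘ₗ opRot a b) P = 0 := by
    refine fischer_ext (by omega) (fun p q H h k l => ?_) P
    rw [LinearMap.comp_apply, commute_apply ((commute_opRot_sqX a b).pow_right k),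
      commute_apply ((commute_opRot_sqU a b).pow_right l),
      pizzetti_fischer hm (h.opRot a b) _ _ p le_rfl]
    refine Finset.sum_eq_zero fun i _ => ?_
    rw [← commute_apply ((commute_opRot_dUdX a b).pow_right _), evalZero_opRot, mul_zero]
  rwa [LinearMap.comp_apply] at this

theorem pizzetti_one (hm : 2 < m) : pizzetti hm 1 = 1 := by
  have hd : ∀ i : Fin m, dX i (1 : Poly m) = 0 := fun i => pderiv_one
  have hd' : ∀ i : Fin m, dU i (1 : Poly m) = 0 := fun i => pderiv_one
  have h : DoubleHarmonic (m := m) ((0 : ℕ) : ℂ) ((0 : ℕ) : ℂ) 1 :=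
    { x := by simp [eulerX_apply, hd]
      u := by simp [eulerU_apply, hd']
      lapX_eq := by simp [lapX_apply, hd]
      lapU_eq := by simp [lapU_apply, hd'] }
  have := pizzetti_fischer hm h 0 0 0 le_rfl
  simpa [gammaCoeff, rising, evalZero_apply] using this

/-! ### The Pizzetti functional vanishes on multiples of `⟨x,u⟩` -/

/-- The ratio of consecutive `γ_i`, with the halves cleared against `16`: exactly the cancellation
needed in `pizzetti_innerXU_mul`. -/
theorem gammaCoeff_succ (hm : 2 < m) (i : ℕ) :
    gammaCoeff m (i + 1) * ((2 * i + 2) * (4 * i + m) * (4 * i + m + 2) * (2 * i + m - 1)) =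
      -gammaCoeff m i := by
  have h1 : ∀ n : ℕ, rising ((m : ℂ) / 2) n ≠ 0 := by
    refine fun n => Finset.prod_ne_zero_iff.2 fun k _ h => ?_
    have : ((m + 2 * k : ℕ) : ℂ) = 0 := by push_cast; linear_combination 2 * h
    have := Nat.cast_eq_zero.1 this
    omega
  have h2 : ∀ n : ℕ, rising (((m : ℂ) - 1) / 2) n ≠ 0 := by
    refine fun n => Finset.prod_ne_zero_iff.2 fun k _ h => ?_
    have : ((m + 2 * k : ℕ) : ℂ) = ((1 : ℕ) : ℂ) := by push_cast; linear_combination 2 * h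
    have := Nat.cast_injective this
    omega
  have h3 : rising ((m : ℂ) / 2) (2 * (i + 1)) =
      rising ((m : ℂ) / 2) (2 * i) * (m / 2 + 2 * i) * (m / 2 + 2 * i + 1) := by
    rw [rising, show 2 * (i + 1) = 2 * i + 1 + 1 by ring, Finset.prod_range_succ,
      Finset.prod_range_succ, rising]
    push_cast
    ring
  have h4 : rising (((m : ℂ) - 1) / 2) (i + 1) =
      rising (((m : ℂ) - 1) / 2) i * ((m - 1) / 2 + i) := by
    rw [rising, Finset.prod_range_succ, rising]
  have h5 := h1 (2 * (i + 1))
  have h6 := h2 (i + 1)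
  have h7 : ((i + 1).factorial : ℂ) ≠ 0 := Nat.cast_ne_zero.2 (Nat.factorial_ne_zero _)
  have h8 : ((i.factorial : ℕ) : ℂ) ≠ 0 := Nat.cast_ne_zero.2 (Nat.factorial_ne_zero _)
  have h9 := h1 (2 * i)
  have h10 := h2 i
  have hden : ∀ j : ℕ, (4 : ℂ) ^ (2 * j) ≠ 0 := fun j => pow_ne_zero _ (by norm_num)
  rw [gammaCoeff, gammaCoeff, div_mul_eq_mul_div, neg_div',
    div_eq_div_iff (mul_ne_zero (mul_ne_zero (mul_ne_zero (hden _) h7) h5) h6)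
      (mul_ne_zero (mul_ne_zero (mul_ne_zero (hden _) h8) h9) h10), h3, h4, Nat.factorial_succ]
  push_cast
  ring

theorem Bihom.lapX_normSqX_mul {p q : ℂ} {P : Poly m} (h : Bihom p q P)
    (hP : StiefelPizzetti.lapX P = 0) :
    StiefelPizzetti.lapX (StiefelPizzetti.normSqX * P) = (4 * p + 2 * m) • P := by
  rw [StiefelPizzetti.lapX_normSqX_mul, hP, h.x, mul_zero]
  module

theorem Bihom.lapU_normSqU_mul {p q : ℂ} {P : Poly m} (h : Bihom p q P)
    (hP : StiefelPizzetti.lapU P = 0) :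
    StiefelPizzetti.lapU (StiefelPizzetti.normSqU * P) = (4 * q + 2 * m) • P := by
  rw [StiefelPizzetti.lapU_normSqU_mul, hP, h.u, mul_zero]
  module

/-- The double harmonic part of `⟨u, ∂_x⟩ H`. -/
theorem DoubleHarmonic.opF_sub {p q c : ℂ} {H : Poly m} (h : DoubleHarmonic p q H)
    (hc : c = 2 * q + m - 2) (hc0 : c ≠ 0) : DoubleHarmonic (p - 1) (q + 1)
      (opF H - c⁻¹ • (normSqU * StiefelPizzetti.dUdX H)) where
  toBihom := h.toBihom.opF.sub
    (((Bihom.normSqU.mul h.toBihom.dUdX).congr_deg (by ring) (by ring)).smul _)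
  lapX_eq := by
    rw [map_sub, map_smul, lapX_opF, h.lapX_eq, lapX_normSqU_mul, h.dUdX.lapX_eq]
    simp
  lapU_eq := by
    rw [map_sub, map_smul, lapU_opF, h.lapU_eq, h.dUdX.toBihom.lapU_normSqU_mul h.dUdX.lapU_eq,
      smul_smul, map_zero, zero_add, ← sub_smul]
    -- `Δ_u opF H = 2 D H`, whereas `Δ_u(|u|² D H) = (4(q-1) + 2m) D H = 2c D H`; hence the factor
    -- `c⁻¹`.
    convert zero_smul ℂ _
    rw [hc] at hc0 ⊢
    field_simp
    ring

/-- The double harmonic part of `⟨x, ∂_u⟩ H`. -/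
theorem DoubleHarmonic.opE_sub {p q c : ℂ} {H : Poly m} (h : DoubleHarmonic p q H)
    (hc : c = 2 * p + m - 2) (hc0 : c ≠ 0) : DoubleHarmonic (p + 1) (q - 1)
      (opE H - c⁻¹ • (normSqX * StiefelPizzetti.dUdX H)) where
  toBihom := h.toBihom.opE.sub
    (((Bihom.normSqX.mul h.toBihom.dUdX).congr_deg (by ring) (by ring)).smul _)
  lapU_eq := by
    rw [map_sub, map_smul, lapU_opE, h.lapU_eq, lapU_normSqX_mul, h.dUdX.lapU_eq]
    simp
  lapX_eq := by
    rw [map_sub, map_smul, lapX_opE, h.lapX_eq, h.dUdX.toBihom.lapX_normSqX_mul h.dUdX.lapX_eq,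
      smul_smul, map_zero, zero_add, ← sub_smul]
    convert zero_smul ℂ _
    rw [hc] at hc0 ⊢
    field_simp
    ring

/-- Both parts of the corrected `⟨u,∂_x⟩H` vanish at the origin after any power of `D`, because
`Δ_x` kills `H` and `D H`. -/
theorem DoubleHarmonic.pizzetti_opF (hm : 2 < m) {p q c : ℂ} {H : Poly m}
    (h : DoubleHarmonic p q H) (hc : c = 2 * q + m - 2) (hc0 : c ≠ 0) :
    pizzetti hm (opF H - c⁻¹ • (normSqU * StiefelPizzetti.dUdX H)) = 0 := by
  obtain ⟨N, hN⟩ := ((h.opF_sub hc hc0).eventually_pizzetti hm).exists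
  rw [hN]
  refine Finset.sum_eq_zero fun i _ => ?_
  rw [map_sub, map_smul, map_sub, map_smul, evalZero_dUdX_pow_opF h.lapX_eq,
    evalZero_dUdX_pow_normSqU_mul h.dUdX.lapX_eq]
  simp

theorem DoubleHarmonic.pizzetti_opE (hm : 2 < m) {p q c : ℂ} {H : Poly m}
    (h : DoubleHarmonic p q H) (hc : c = 2 * p + m - 2) (hc0 : c ≠ 0) :
    pizzetti hm (opE H - c⁻¹ • (normSqX * StiefelPizzetti.dUdX H)) = 0 := by
  obtain ⟨N, hN⟩ := ((h.opE_sub hc hc0).eventually_pizzetti hm).exists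
  rw [hN]
  refine Finset.sum_eq_zero fun i _ => ?_
  rw [map_sub, map_smul, map_sub, map_smul, evalZero_dUdX_pow_opE h.lapU_eq,
    evalZero_dUdX_pow_normSqX_mul h.dUdX.lapU_eq]
  simp

/-- The double harmonic part of `⟨x, u⟩ H`. -/
theorem DoubleHarmonic.innerXU_mul_sub {p q c d : ℂ} {H : Poly m} (h : DoubleHarmonic p q H)
    (hc : c = 2 * p + m - 2) (hc0 : c ≠ 0) (hd : d = 2 * q + m - 2) (hd0 : d ≠ 0) :
    DoubleHarmonic (p + 1) (q + 1)
      (innerXU * H - c⁻¹ • (normSqX * (opF H - d⁻¹ • (normSqU * StiefelPizzetti.dUdX H))) -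
        d⁻¹ • (normSqU * (opE H - c⁻¹ • (normSqX * StiefelPizzetti.dUdX H))) -
        (c * d)⁻¹ • (normSqX * (normSqU * StiefelPizzetti.dUdX H))) := by
  have hF := h.opF_sub hd hd0
  have hE := h.opE_sub hc hc0
  have hB : Bihom (p - 1) (q + 1) (normSqU * StiefelPizzetti.dUdX H) :=
    (Bihom.normSqU.mul h.dUdX.toBihom).congr_deg (by ring) (by ring)
  have hB' : Bihom (p + 1) (q - 1) (normSqX * StiefelPizzetti.dUdX H) :=
    (Bihom.normSqX.mul h.dUdX.toBihom).congr_deg (by ring) (by ring)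
  refine ⟨?_, ?_, ?_⟩
  · refine ((Bihom.sub ?_ (.smul _ ?_)).sub (.smul _ ?_)).sub (.smul _ ?_)
    · exact (Bihom.innerXU.mul h.toBihom).congr_deg (by ring) (by ring)
    · exact (Bihom.normSqX.mul hF.toBihom).congr_deg (by ring) (by ring)
    · exact (Bihom.normSqU.mul hE.toBihom).congr_deg (by ring) (by ring)
    · exact (Bihom.normSqX.mul hB).congr_deg (by ring) (by ring)
  -- `Δ_x(⟨x,u⟩H) = 2 opF H` is cancelled by the `|x|²` correction except for `2d⁻¹|u|² D H`, which
  -- the last correction removes; the `|u|²` correction is harmonic in `x`.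
  · rw [map_sub, map_sub, map_sub, map_smul, map_smul, map_smul, lapX_innerXU_mul, h.lapX_eq,
      hF.toBihom.lapX_normSqX_mul hF.lapX_eq, lapX_normSqU_mul, hE.lapX_eq,
      hB.lapX_normSqX_mul (by rw [lapX_normSqU_mul, h.dUdX.lapX_eq, mul_zero]),
      show 4 * (p - 1) + 2 * (m : ℂ) = 2 * c by rw [hc]; ring, mul_zero, mul_zero, mul_inv]
    match_scalars <;> field_simp <;> ring
  · rw [map_sub, map_sub, map_sub, map_smul, map_smul, map_smul, lapU_innerXU_mul, h.lapU_eq,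
      hE.toBihom.lapU_normSqU_mul hE.lapU_eq, lapU_normSqX_mul, hF.lapU_eq,
      mul_left_comm normSqX normSqU,
      hB'.lapU_normSqU_mul (by rw [lapU_normSqX_mul, h.dUdX.lapU_eq, mul_zero]),
      show 4 * (q - 1) + 2 * (m : ℂ) = 2 * d by rw [hd]; ring, mul_zero, mul_zero, mul_inv]
    match_scalars <;> field_simp <;> ring

/-- For double harmonic `H`, the value at `⟨x,u⟩H` is the value at its double harmonic part `T` plus
`(cd)⁻¹` times the value at `D H`. Term `i + 1` of the former cancels term `i` of the latter. -/
theorem pizzetti_innerXU_mul (hm : 2 < m) (P : Poly m) : pizzetti hm (innerXU * P) = 0 := by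
  suffices (pizzetti hm ∘ₗ LinearMap.mulLeft ℂ innerXU) P = 0 by
    rwa [LinearMap.comp_apply, LinearMap.mulLeft_apply] at this
  refine fischer_ext (by omega) (fun p q H h a b => ?_) P
  have hX : Commute (LinearMap.mulLeft ℂ innerXU) (sqX : Module.End ℂ (Poly m)) :=
    LinearMap.ext fun P => by
      simp only [Module.End.mul_apply, LinearMap.mulLeft_apply, sqX_apply]; ring
  have hU : Commute (LinearMap.mulLeft ℂ innerXU) (sqU : Module.End ℂ (Poly m)) :=
    LinearMap.ext fun P => by
      simp only [Module.End.mul_apply, LinearMap.mulLeft_apply, sqU_apply]; ring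
  rw [LinearMap.comp_apply, commute_apply (hX.pow_right a),
    commute_apply (hU.pow_right b), pizzetti_sqX_pow, pizzetti_sqU_pow, LinearMap.mulLeft_apply]
  have hne : ∀ n : ℕ, 2 * (n : ℂ) + m - 2 ≠ 0 := by
    intro n hn
    have : ((2 * n + m : ℕ) : ℂ) = ((2 : ℕ) : ℂ) := by push_cast; linear_combination hn
    have := Nat.cast_injective this
    omega
  obtain ⟨c, hc⟩ : ∃ c : ℂ, c = 2 * p + m - 2 := ⟨_, rfl⟩
  obtain ⟨d, hd⟩ : ∃ d : ℂ, d = 2 * q + m - 2 := ⟨_, rfl⟩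
  have hc0 : c ≠ 0 := hc ▸ hne p
  have hd0 : d ≠ 0 := hd ▸ hne q
  have hT := h.innerXU_mul_sub hc hc0 hd hd0
  have hF := h.opF_sub hd hd0
  have hE := h.opE_sub hc hc0
  have hsplit : pizzetti hm (innerXU * H) = pizzetti hm
      (innerXU * H - c⁻¹ • (normSqX * (opF H - d⁻¹ • (normSqU * dUdX H))) -
        d⁻¹ • (normSqU * (opE H - c⁻¹ • (normSqX * dUdX H))) -
        (c * d)⁻¹ • (normSqX * (normSqU * dUdX H))) + (c * d)⁻¹ * pizzetti hm (dUdX H) := by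
    rw [map_sub, map_sub, map_sub, map_smul, map_smul, map_smul, pizzetti_normSqX_mul,
      pizzetti_normSqU_mul, pizzetti_normSqX_mul, pizzetti_normSqU_mul, h.pizzetti_opF hm hd hd0,
      h.pizzetti_opE hm hc hc0]
    simp
  -- The cut-off for `T` is one higher: its term of index `0` vanishes at the origin, and the
  -- remaining ones pair with those of `D H`.
  obtain ⟨N, hN1, hN2⟩ := (((Filter.tendsto_add_atTop_nat 1).eventually
    (hT.eventually_pizzetti hm)).and (h.dUdX.eventually_pizzetti hm)).exists
  rw [hsplit, hN1, hN2, Finset.sum_range_succ', Finset.mul_sum]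
  simp only [mul_zero, pow_zero, Module.End.one_apply, map_sub, map_smul,
    evalZero_innerXU_mul, evalZero_normSqX_mul, evalZero_normSqU_mul, smul_zero, sub_zero, add_zero]
  rw [← Finset.sum_add_distrib]
  refine Finset.sum_eq_zero fun i _ => ?_
  rw [show 2 * (i + 1) = 2 * i + 1 + 1 by ring, dUdX_pow_innerXU_mul h.toBihom,
    show 2 * i + 1 + 1 = 2 * i + 2 by ring, evalZero_dUdX_pow_normSqX_mul hF.lapU_eq,
    evalZero_dUdX_pow_normSqU_mul hE.lapX_eq, dUdX_pow_normSqX_mul,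
    commute_apply (commute_lapU_dUdX.pow_right _),
    h.dUdX.toBihom.lapU_normSqU_mul h.dUdX.lapU_eq]
  have hpow : (dUdX ^ (2 * i)) (dUdX H) = (dUdX ^ (2 * i + 1)) H := by
    rw [pow_succ, Module.End.mul_apply]
  simp only [map_add, map_smul, evalZero_innerXU_mul, evalZero_normSqX_mul, evalZero_opE, zero_add,
    smul_eq_mul, hpow]
  -- Both terms are multiples of `(D^{2i+1}H)(0)`, non-zero only if `p = q = 2i + 1`. Then `c = d =
  -- 4i + m`, and the identity `(2i+m+1)(4i+m) - 2(2i+1) = (4i+m+2)(2i+m-1)` turns the claim into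
  -- the recursion for `γ_i`.
  by_cases hpq : (p : ℂ) ≠ (2 * i + 1 : ℕ) ∨ (q : ℂ) ≠ (2 * i + 1 : ℕ)
  · rw [h.toBihom.evalZero_dUdX_pow hpq]
    ring
  · rw [not_or, not_not, not_not] at hpq
    have hm' : (m : ℂ) = c - 4 * i := by rw [hc, hpq.1]; push_cast; ring
    have hd' : d = c := by rw [hc, hd, hpq.1, hpq.2]
    rw [hpq.1, hpq.2, ← neg_eq_iff_eq_neg.2 (gammaCoeff_succ hm i), hd', hm']
    push_cast
    field_simp
    ring

/-! ## Uniqueness of the invariant functional -/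

theorem opE_X_inr_mul (a : Fin m) (Q : Poly m) :
    opE (X (Sum.inr a) * Q) = X (Sum.inl a) * Q + X (Sum.inr a) * opE Q := by
  simp only [opE_apply, dU_mul, dU_X_inr, ite_mul, one_mul, zero_mul, mul_add, mul_ite, mul_zero,
    Finset.sum_add_distrib, Finset.sum_ite_eq', Finset.mem_univ, if_true, Finset.mul_sum,
    mul_left_comm]

/-- The left-hand side is annihilated by every rotation-invariant functional, so each choice of `Q`
yields a linear relation among its values. -/
theorem sum_opRot_X_inl_mul (a : Fin m) (Q : Poly m) :
    ∑ b, opRot a b (X (Sum.inl b) * Q) = ((m : ℂ) - 1) • (X (Sum.inl a) * Q) +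
      X (Sum.inl a) * eulerX Q - normSqX * dX a Q + X (Sum.inr a) * opE Q - innerXU * dU a Q := by
  have h1 : ∑ b, opRot a b (X (Sum.inl b)) * Q = ((m : ℂ) - 1) • (X (Sum.inl a) * Q) := by
    simp only [opRot_apply, dX_X_inl, dU_X_inl, if_true, mul_ite, mul_one, mul_zero, add_zero,
      sub_zero, sub_mul, ite_mul, zero_mul, Finset.sum_sub_distrib, Finset.sum_ite_eq,
      Finset.mem_univ, Finset.sum_const, Finset.card_univ, Fintype.card_fin, sub_smul, one_smul,
      Nat.cast_smul_eq_nsmul]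
  simp only [opRot_mul, Finset.sum_add_distrib]
  rw [h1]
  simp only [add_assoc, add_sub_assoc]
  congr 1
  simp only [opRot_apply, eulerX_apply, opE_apply, normSqX, innerXU, Finset.mul_sum, Finset.sum_mul,
    ← Finset.sum_add_distrib, ← Finset.sum_sub_distrib]
  exact Finset.sum_congr rfl fun b _ => by ring

theorem sum_opRot_X_inr_mul (a : Fin m) (Q : Poly m) :
    ∑ b, opRot a b (X (Sum.inr b) * Q) = ((m : ℂ) - 1) • (X (Sum.inr a) * Q) +
      X (Sum.inr a) * eulerU Q - normSqU * dU a Q + X (Sum.inl a) * opF Q - innerXU * dX a Q := by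
  have h1 : ∑ b, opRot a b (X (Sum.inr b)) * Q = ((m : ℂ) - 1) • (X (Sum.inr a) * Q) := by
    simp only [opRot_apply, dX_X_inr, dU_X_inr, if_true, mul_ite, mul_one, mul_zero, zero_add,
      sub_zero, sub_mul, ite_mul, zero_mul, Finset.sum_sub_distrib, Finset.sum_ite_eq,
      Finset.mem_univ, Finset.sum_const, Finset.card_univ, Fintype.card_fin, sub_smul, one_smul,
      Nat.cast_smul_eq_nsmul]
  simp only [opRot_mul, Finset.sum_add_distrib]
  rw [h1]
  simp only [add_assoc, add_sub_assoc]
  congr 1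
  simp only [opRot_apply, eulerU_apply, opF_apply, normSqU, innerXU, Finset.mul_sum, Finset.sum_mul,
    ← Finset.sum_add_distrib, ← Finset.sum_sub_distrib]
  exact Finset.sum_congr rfl fun b _ => by ring

/-- For a functional as in `eq_zero_of_invariant` this reads `M(opE Q) = M(opF Q)`. -/
theorem sum_sum_opRot_mul (Q : Poly m) :
    ∑ a, ∑ b, opRot a b (X (Sum.inl b) * (X (Sum.inr a) * Q)) =
      innerXU * eulerX Q - normSqX * opF Q + normSqU * opE Q - innerXU * eulerU Q := by
  have h1 : ∀ R : Poly m, ∑ a, X (Sum.inl a) * (X (Sum.inr a) * R) = innerXU * R := fun R => by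
    simp only [innerXU, Finset.sum_mul, mul_assoc]
  have h2 : ∀ R : Poly m, ∑ a, X (Sum.inr a) * (X (Sum.inr a) * R) = normSqU * R := fun R => by
    simp only [normSqU, Finset.sum_mul, pow_two, mul_assoc]
  have h3 : ∀ a, ∑ b, opRot a b (X (Sum.inl b) * (X (Sum.inr a) * Q)) =
      (m : ℂ) • (X (Sum.inl a) * (X (Sum.inr a) * Q)) +
        X (Sum.inl a) * (X (Sum.inr a) * eulerX Q) - normSqX * (X (Sum.inr a) * dX a Q) +
        X (Sum.inr a) * (X (Sum.inr a) * opE Q) - innerXU * Q -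
        innerXU * (X (Sum.inr a) * dU a Q) := fun a => by
    simp only [sum_opRot_X_inl_mul, eulerX_mul, eulerX_X_inr, dX_mul, dX_X_inr, dU_mul, dU_X_inr,
      if_true, zero_mul, zero_add, one_mul, opE_X_inr_mul, sub_smul, one_smul]
    ring
  simp only [h3, Finset.sum_add_distrib, Finset.sum_sub_distrib, ← Finset.smul_sum,
    ← Finset.mul_sum, h1, h2, ← opF_apply, ← eulerU_apply, Finset.sum_const, Finset.card_univ,
    Fintype.card_fin, ← Nat.cast_smul_eq_nsmul ℂ, mul_smul_comm]
  generalize (m : ℂ) • (innerXU * Q : Poly m) = R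
  ring

/-- A linear functional on polynomials that is invariant under infinitesimal rotations and
compatible with the equations of the Stiefel manifold vanishes if it vanishes at `1`. -/
theorem eq_zero_of_invariant (hm : 2 < m) {M : Poly m →ₗ[ℂ] ℂ}
    (hX : ∀ P, M (normSqX * P) = M P) (hU : ∀ P, M (normSqU * P) = M P)
    (hXU : ∀ P, M (innerXU * P) = 0) (hrot : ∀ a b P, M (opRot a b P) = 0) (h1 : M 1 = 0) :
    M = 0 := by
  have hEF : ∀ Q, M (opE Q) = M (opF Q) := by
    intro Q
    have := congrArg M (sum_sum_opRot_mul Q)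
    simp only [map_sum, hrot, Finset.sum_const_zero, map_sub, map_add, hX, hU, hXU] at this
    linear_combination -this
  have hx : ∀ (p q : ℂ) (P : Poly m), Bihom p q P →
      p * (m + p - 3) * M P = M (lapX P) - M (opF (opF P)) := by
    intro p q P h
    -- Take `Q = ∂_{x_a}P` and sum over `a`. The coefficient `m + p - 2` is `(m-1) + (p-1)`, and
    -- moving `u_a` inside `opE` costs one more `𝔼_x P`, whence `m + p - 3`. Under `M` the term `opE
    -- (opF P)` becomes `opF (opF P)`, of degree `p - 2` in `x`.
    have hsum : ∑ a, ∑ b, opRot a b (X (Sum.inl b) * dX a P) =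
        (p * (m + p - 3)) • P - normSqX * lapX P + opE (opF P) - innerXU * dUdX P := by
      have h3 : (p * (m + p - 3)) • P = (m + p - 2) • eulerX P - eulerX P := by
        rw [h.x]; module
      rw [h3, eulerX_apply, lapX_apply, dUdX_apply, opF_apply, map_sum]
      simp only [sum_opRot_X_inl_mul, (h.dX _).x, opE_X_inr_mul, Finset.smul_sum, Finset.mul_sum,
        ← Finset.sum_add_distrib, ← Finset.sum_sub_distrib]
      refine Finset.sum_congr rfl fun a _ => ?_
      rw [mul_smul_comm]
      module
    have := congrArg M hsum
    simp only [map_sum, hrot, Finset.sum_const_zero, map_sub, map_add, hX, hXU, hEF, map_smul,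
      smul_eq_mul] at this
    linear_combination -this
  have hu : ∀ (q : ℂ) (P : Poly m), Bihom 0 q P → q * (m + q - 2) * M P = M (lapU P) := by
    intro q P h
    have hd : ∀ a, dX a P = 0 := fun a => (h.dX a).eq_zero_of_x fun n =>
      natCast_ne_neg_of_pos (k := 1) one_pos _ (by push_cast; ring)
    have hsum : ∑ a, ∑ b, opRot a b (X (Sum.inr b) * dU a P) =
        (q * (m + q - 2)) • P - normSqU * lapU P := by
      have h3 : (q * (m + q - 2)) • P = (m + q - 2) • eulerU P := by
        rw [h.u]; module
      rw [h3, eulerU_apply, lapU_apply]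
      simp only [sum_opRot_X_inr_mul, (h.dU _).u, opF_apply, dX_dU, hd, map_zero, mul_zero,
        Finset.sum_const_zero, add_zero, sub_zero, Finset.smul_sum, Finset.mul_sum,
        ← Finset.sum_sub_distrib]
      refine Finset.sum_congr rfl fun a _ => ?_
      rw [mul_smul_comm]
      module
    have := congrArg M hsum
    simp only [map_sum, hrot, Finset.sum_const_zero, map_sub, hU, map_smul, smul_eq_mul] at this
    linear_combination -this
  have hne : ∀ a b : ℕ, 0 < a → b < m + a → (a : ℂ) * (m + a - b) ≠ 0 := by
    intro a b ha hb
    refine mul_ne_zero (Nat.cast_ne_zero.2 ha.ne') (sub_ne_zero.2 ?_)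
    exact_mod_cast hb.ne'
  have hbase : ∀ (q : ℕ) (P : Poly m), Bihom 0 q P → M P = 0 := by
    intro q
    induction q using Nat.twoStepInduction with
    | zero =>
      intro P h
      -- A polynomial of bidegree `(0,0)` is constant, so `M 1 = 0` applies.
      have hP : P = coeff 0 P • 1 := by
        rw [smul_eq_C_mul, mul_one]
        ext s
        rw [coeff_C]
        split_ifs with hs
        · rw [hs]
        · by_contra hs0
          have h0 := h.degX_eq (mem_support_iff.2 hs0)
          have h0' := h.degU_eq (mem_support_iff.2 hs0)
          rw [Nat.cast_eq_zero, degX, Finset.sum_eq_zero_iff] at h0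
          rw [Nat.cast_inj, degU, Finset.sum_eq_zero_iff] at h0'
          refine hs (Finsupp.ext fun i => ?_)
          rcases i with i | i
          · exact (h0 i (Finset.mem_univ _)).symm
          · exact (h0' i (Finset.mem_univ _)).symm
      rw [hP, map_smul, h1, smul_zero]
    | one =>
      intro P h
      have := hu _ P h
      rw [lapU_mem_and_eq_zero.2.2 P h, map_zero] at this
      exact (mul_eq_zero.1 this).resolve_left (by simpa using hne 1 2 one_pos (by omega))
    | more q ih _ =>
      intro P h
      have := hu _ P h
      rw [ih _ (lapU_mem_and_eq_zero.1 q P h)] at this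
      exact (mul_eq_zero.1 this).resolve_left (by
        simpa using hne (q + 2) 2 (by omega) (by omega))
  have hall : ∀ (p q : ℕ) (P : Poly m), Bihom p q P → M P = 0 := by
    intro p
    induction p using Nat.twoStepInduction with
    | zero => exact fun q P h => hbase q P (by simpa using h)
    | one =>
      intro q P h
      have := hx _ _ P h
      rw [lapX_mem_and_eq_zero.2.2 P h, h.opF.opF.eq_zero_of_x fun n =>
        natCast_ne_neg_of_pos (k := 1) one_pos _ (by push_cast; ring), map_zero, sub_zero] at this
      exact (mul_eq_zero.1 this).resolve_left (by simpa using hne 1 3 one_pos (by omega))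
    | more p ih _ =>
      intro q P h
      have := hx _ _ P h
      rw [ih q _ (lapX_mem_and_eq_zero.1 p P h),
        -- The induction is on `p` with `q` arbitrary, since `opF` moves degree from `x` to `u`.
        ih (q + 2) _ (h.opF.opF.congr_deg (by push_cast; ring) (by push_cast; ring)),
        sub_zero] at this
      exact (mul_eq_zero.1 this).resolve_left (by
        simpa using hne (p + 2) 3 (by omega) (by omega))
  refine LinearMap.ext fun P => ?_
  rw [P.as_sum, map_sum, LinearMap.zero_apply]
  exact Finset.sum_eq_zero fun s _ => hall _ _ _ (Bihom.monomial s _)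

/-! ## Rotations in a coordinate plane -/

/-- The generator of the rotations in the plane spanned by `e_a` and `e_b`. -/
def rotGen (a b : Fin m) : Matrix (Fin m) (Fin m) ℝ := Matrix.single a b 1 - Matrix.single b a 1

/-- The orthogonal projection onto the plane spanned by `e_a` and `e_b`. -/
def rotPlane (a b : Fin m) : Matrix (Fin m) (Fin m) ℝ := Matrix.single a a 1 + Matrix.single b b 1

/-- The rotation by the angle `t` in the plane spanned by `e_a` and `e_b`. -/
def rotMatrix (a b : Fin m) (t : ℝ) : Matrix (Fin m) (Fin m) ℝ :=
  1 + (Real.cos t - 1) • rotPlane a b + Real.sin t • rotGen a b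

section

variable {a b : Fin m}

theorem rotGen_mul_rotGen (hab : a ≠ b) : rotGen a b * rotGen a b = -rotPlane a b := by
  simp [rotGen, rotPlane, mul_sub, sub_mul, hab, hab.symm]
  abel

theorem rotGen_mul_rotPlane (hab : a ≠ b) : rotGen a b * rotPlane a b = rotGen a b := by
  simp [rotGen, rotPlane, sub_mul, mul_add, hab, hab.symm]
  abel

theorem rotPlane_mul_rotGen (hab : a ≠ b) : rotPlane a b * rotGen a b = rotGen a b := by
  simp [rotGen, rotPlane, mul_sub, add_mul, hab, hab.symm]

theorem rotPlane_mul_rotPlane (hab : a ≠ b) : rotPlane a b * rotPlane a b = rotPlane a b := by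
  simp [rotPlane, mul_add, add_mul, hab, hab.symm]

theorem rotMatrix_zero : rotMatrix a b 0 = 1 := by
  simp [rotMatrix]

theorem rotMatrix_add (hab : a ≠ b) (s t : ℝ) :
    rotMatrix a b (s + t) = rotMatrix a b s * rotMatrix a b t := by
  simp only [rotMatrix, mul_add, add_mul, one_mul, mul_one, smul_mul_assoc, mul_smul_comm,
    rotGen_mul_rotGen hab, rotGen_mul_rotPlane hab, rotPlane_mul_rotGen hab,
    rotPlane_mul_rotPlane hab, Real.cos_add, Real.sin_add]
  module

theorem rotMatrix_neg (t : ℝ) : rotMatrix a b (-t) = (rotMatrix a b t).transpose := by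
  simp only [rotMatrix, Matrix.transpose_add, Matrix.transpose_smul, rotPlane, rotGen,
    Matrix.transpose_sub, Matrix.transpose_single, Matrix.transpose_one, Real.cos_neg, Real.sin_neg]
  module

theorem rotMatrix_mem (hab : a ≠ b) (t : ℝ) :
    rotMatrix a b t ∈ Matrix.specialOrthogonalGroup (Fin m) ℝ := by
  have horth : ∀ t, rotMatrix a b t * (rotMatrix a b t).transpose = 1 := fun t => by
    rw [← rotMatrix_neg, ← rotMatrix_add hab, add_neg_cancel, rotMatrix_zero]
  refine Matrix.mem_specialOrthogonalGroup_iff.2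
    ⟨(Matrix.mem_orthogonalGroup_iff _ _).2 (horth t), ?_⟩
  -- Halving the angle fixes the sign: `det R(t) = (det R(t/2))²`, which orthogonality makes equal
  -- to `1`.
  have h := congrArg Matrix.det (horth (t / 2))
  rw [Matrix.det_mul, Matrix.det_transpose, ← Matrix.det_mul, ← rotMatrix_add hab,
    add_halves, Matrix.det_one] at h
  exact h

theorem hasDerivAt_rotMatrix_mul (hab : a ≠ b) (g : Matrix (Fin m) (Fin m) ℝ) (t : ℝ)
    (i k : Fin m) : HasDerivAt (fun t => (rotMatrix a b t * g) i k)
      ((rotGen a b * (rotMatrix a b t * g)) i k) t := by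
  have h1 : (fun t => (rotMatrix a b t * g) i k) = fun t =>
      g i k + (Real.cos t - 1) * (rotPlane a b * g) i k + Real.sin t * (rotGen a b * g) i k := by
    funext t
    simp only [rotMatrix, add_mul, one_mul, smul_mul_assoc, Matrix.add_apply, Matrix.smul_apply,
      smul_eq_mul]
  have h2 : (rotGen a b * (rotMatrix a b t * g)) i k =
      -Real.sin t * (rotPlane a b * g) i k + Real.cos t * (rotGen a b * g) i k := by
    have h3 : rotGen a b * rotMatrix a b t =
        (-Real.sin t) • rotPlane a b + Real.cos t • rotGen a b := by
      simp only [rotMatrix, mul_add, mul_one, mul_smul_comm, rotGen_mul_rotGen hab,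
        rotGen_mul_rotPlane hab]
      module
    rw [← mul_assoc, h3]
    simp only [add_mul, smul_mul_assoc, Matrix.add_apply, Matrix.smul_apply, smul_eq_mul]
  rw [h1, h2]
  exact ((((Real.hasDerivAt_cos t).sub_const 1).mul_const _).const_add _).add
    ((Real.hasDerivAt_sin t).mul_const _)

theorem rotGen_mul_apply (g : Matrix (Fin m) (Fin m) ℝ) (i k : Fin m) :
    (rotGen a b * g) i k = (if i = a then g b k else 0) - if i = b then g a k else 0 := by
  simp only [rotGen, sub_mul, Matrix.sub_apply, Matrix.mul_apply, Matrix.single_apply, ite_and,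
    ite_mul, one_mul, zero_mul, eq_comm]
  split_ifs <;> simp

end

theorem hasDerivAt_eval {σ : Type*} [Fintype σ] (P : MvPolynomial σ ℂ) {y : ℝ → σ → ℂ}
    {y' : σ → ℂ} {t : ℝ} (h : ∀ i, HasDerivAt (fun t => y t i) (y' i) t) :
    HasDerivAt (fun t => eval (y t) P) (∑ i, y' i * eval (y t) (pderiv i P)) t := by
  classical
  induction P using MvPolynomial.induction_on with
  | C c => simpa using hasDerivAt_const t c
  | add P Q hP hQ =>
    simp only [map_add, mul_add, Finset.sum_add_distrib]
    exact hP.add hQ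
  | mul_X P j hP =>
    have := hP.mul (h j)
    simp only [map_mul, eval_X, pderiv_mul, map_add, mul_add, Finset.sum_add_distrib, pderiv_X]
    refine this.congr_deriv ?_
    rw [Finset.sum_mul]
    congr 1
    · exact Finset.sum_congr rfl fun i _ => by ring
    · rw [Finset.sum_eq_single j]
      · simp [mul_comm]
      · intro i _ hi
        simp [hi.symm]
      · simp

/-! ## The integral over the Stiefel manifold -/

/-- The value of a polynomial at the first two columns of an element of `SO(m)`. -/
def colEval (hm : 4 < m) (P : Poly m) (g : SO m) : ℂ :=
  evalAt P (toStiefel hm g).1.1 (toStiefel hm g).1.2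

theorem continuous_evalAt (P : Poly m) :
    Continuous fun p : stiefel m => evalAt P p.1.1 p.1.2 := by
  refine (MvPolynomial.continuous_eval P).comp (continuous_pi fun i => ?_)
  rcases i with i | i
  · exact Complex.continuous_ofReal.comp ((EuclideanSpace.proj i).continuous.comp
      (continuous_fst.comp continuous_subtype_val))
  · exact Complex.continuous_ofReal.comp ((EuclideanSpace.proj i).continuous.comp
      (continuous_snd.comp continuous_subtype_val))

theorem continuous_colEval (hm : 4 < m) (P : Poly m) : Continuous (colEval hm P) :=
  (continuous_evalAt P).comp (continuous_toStiefel hm)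

theorem integrable_colEval (hm : 4 < m) (P : Poly m) : Integrable (colEval hm P) (haarSO m) :=
  (continuous_colEval hm P).integrable_of_hasCompactSupport (HasCompactSupport.of_compactSpace _)

theorem integrable_evalAt (hm : 4 < m) (P : Poly m) :
    Integrable (fun p : stiefel m => evalAt P p.1.1 p.1.2) (stiefelMeasure hm) :=
  (integrable_map_measure (continuous_evalAt P).aestronglyMeasurable
    (continuous_toStiefel hm).measurable.aemeasurable).2 (integrable_colEval hm P)

theorem integral_evalAt (hm : 4 < m) (P : Poly m) :
    ∫ p : stiefel m, evalAt P p.1.1 p.1.2 ∂(stiefelMeasure hm) = ∫ g, colEval hm P g ∂(haarSO m) :=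
  integral_map (continuous_toStiefel hm).measurable.aemeasurable
    (continuous_evalAt P).aestronglyMeasurable

instance : (haarSO m).IsMulLeftInvariant :=
  inferInstanceAs
    (Measure.haarMeasure (⊤ : TopologicalSpace.PositiveCompacts (SO m))).IsMulLeftInvariant

/-- The integral over the Stiefel manifold as a linear functional. -/
def stiefelIntegral (hm : 4 < m) : Poly m →ₗ[ℂ] ℂ where
  toFun P := ∫ g, colEval hm P g ∂(haarSO m)
  map_add' P Q := by
    rw [← integral_add (integrable_colEval hm P) (integrable_colEval hm Q)]
    simp [colEval, evalAt]
  map_smul' c P := by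
    rw [RingHom.id_apply, ← integral_smul]
    simp [colEval, evalAt, smul_eval]

theorem stiefelIntegral_apply (hm : 4 < m) (P : Poly m) :
    stiefelIntegral hm P = ∫ g, colEval hm P g ∂(haarSO m) := rfl

theorem colEval_mul (hm : 4 < m) (P Q : Poly m) (g : SO m) :
    colEval hm (P * Q) g = colEval hm P g * colEval hm Q g := map_mul _ _ _

theorem sum_col_mul (g : SO m) (k l : Fin m) :
    ∑ i, ((g : Matrix (Fin m) (Fin m) ℝ) i k : ℂ) * ((g : Matrix (Fin m) (Fin m) ℝ) i l : ℂ) =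
      if k = l then 1 else 0 := by
  have h := congrFun (congrFun (SO.transpose_mul g) k) l
  rw [Matrix.mul_apply, Matrix.one_apply] at h
  simp only [Matrix.transpose_apply] at h
  rw [← Complex.ofReal_inj, Complex.ofReal_sum] at h
  simpa only [Complex.ofReal_mul, apply_ite Complex.ofReal, Complex.ofReal_one,
    Complex.ofReal_zero] using h

theorem colEval_X_inl (hm : 4 < m) (g : SO m) (i : Fin m) : colEval hm (X (Sum.inl i)) g =
    ((g : Matrix (Fin m) (Fin m) ℝ) i ⟨0, by omega⟩ : ℂ) := eval_X _

theorem colEval_X_inr (hm : 4 < m) (g : SO m) (i : Fin m) : colEval hm (X (Sum.inr i)) g =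
    ((g : Matrix (Fin m) (Fin m) ℝ) i ⟨1, by omega⟩ : ℂ) := eval_X _

theorem colEval_sum (hm : 4 < m) {ι : Type*} (s : Finset ι) (f : ι → Poly m) (g : SO m) :
    colEval hm (∑ i ∈ s, f i) g = ∑ i ∈ s, colEval hm (f i) g := map_sum _ _ _

theorem colEval_normSqX (hm : 4 < m) (g : SO m) : colEval hm normSqX g = 1 := by
  simp only [normSqX, colEval_sum, pow_two, colEval_mul, colEval_X_inl, sum_col_mul, if_true]

theorem colEval_normSqU (hm : 4 < m) (g : SO m) : colEval hm normSqU g = 1 := by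
  simp only [normSqU, colEval_sum, pow_two, colEval_mul, colEval_X_inr, sum_col_mul, if_true]

theorem colEval_innerXU (hm : 4 < m) (g : SO m) : colEval hm innerXU g = 0 := by
  simp only [innerXU, colEval_sum, colEval_mul, colEval_X_inl, colEval_X_inr, sum_col_mul]
  exact if_neg (by simp)

/-- By left invariance of Haar measure, `t ↦ ∫ P(R(t)g) dg` is constant; its derivative at `0` is
minus the integral in question. -/
theorem stiefelIntegral_opRot (hm : 4 < m) (a b : Fin m) (P : Poly m) :
    stiefelIntegral hm (opRot a b P) = 0 := by
  rcases eq_or_ne a b with rfl | hab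
  · rw [show opRot a a P = 0 by rw [opRot_apply]; ring, map_zero]
  let r : ℝ → SO m := fun t => ⟨rotMatrix a b t, rotMatrix_mem hab t⟩
  -- The sign arises because `rotGen a b` puts `g_b` in row `a` and `-g_a` in row `b`, the direction
  -- opposite to `opRot a b`.
  have hderiv : ∀ (g : SO m) (t : ℝ), HasDerivAt (fun t => colEval hm P (r t * g))
      (-colEval hm (opRot a b P) (r t * g)) t := by
    intro g t
    have hx : ∀ i k, HasDerivAt
        (fun t => (((r t * g : SO m) : Matrix (Fin m) (Fin m) ℝ) i k : ℂ))
        (((rotGen a b * ((r t * g : SO m) : Matrix (Fin m) (Fin m) ℝ)) i k : ℝ) : ℂ) t :=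
      fun i k => (hasDerivAt_rotMatrix_mul hab g.1 t i k).ofReal_comp
    have h := hasDerivAt_eval P (t := t)
      (y := fun t => Sum.elim
        (fun i => (((r t * g : SO m) : Matrix (Fin m) (Fin m) ℝ) i ⟨0, by omega⟩ : ℂ))
        fun i => (((r t * g : SO m) : Matrix (Fin m) (Fin m) ℝ) i ⟨1, by omega⟩ : ℂ))
      (y' := Sum.elim
        (fun i => (((rotGen a b * ((r t * g : SO m) : Matrix (Fin m) (Fin m) ℝ)) i
          ⟨0, by omega⟩ : ℝ) : ℂ))
        fun i => (((rotGen a b * ((r t * g : SO m) : Matrix (Fin m) (Fin m) ℝ)) i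
          ⟨1, by omega⟩ : ℝ) : ℂ))
      (by rintro (i | i) <;> exact hx i _)
    refine HasDerivAt.congr_deriv (f := fun t => colEval hm P (r t * g)) h ?_
    change ∑ i, _ * colEval hm (pderiv i P) (r t * g) = _
    have hsub : ∀ P Q : Poly m, colEval hm (P - Q) (r t * g) =
        colEval hm P (r t * g) - colEval hm Q (r t * g) := fun P Q => map_sub _ _ _
    have hadd : ∀ P Q : Poly m, colEval hm (P + Q) (r t * g) =
        colEval hm P (r t * g) + colEval hm Q (r t * g) := fun P Q => map_add _ _ _
    rw [Fintype.sum_sum_type, opRot_apply]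
    simp only [hsub, hadd, colEval_mul, colEval_X_inl, colEval_X_inr, Sum.elim_inl, Sum.elim_inr,
      rotGen_mul_apply, Complex.ofReal_sub, apply_ite Complex.ofReal, Complex.ofReal_zero, sub_mul,
      ite_mul, zero_mul, Finset.sum_sub_distrib, Finset.sum_ite_eq', Finset.mem_univ, if_true]
    simp only [dX, dU, Derivation.coeFn_coe]
    ring
  -- Compactness of `SO(m)` bounds the derivative uniformly in `t`, which justifies differentiating
  -- under the integral.
  obtain ⟨K, hK⟩ := isCompact_univ.exists_bound_of_continuousOn
    (continuous_colEval hm (opRot a b P)).continuousOn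
  have hmain := (hasDerivAt_integral_of_dominated_loc_of_deriv_le (μ := haarSO m) (x₀ := (0 : ℝ))
    (s := Set.univ) (F := fun t g => colEval hm P (r t * g))
    (F' := fun t g => -colEval hm (opRot a b P) (r t * g)) (bound := fun _ => K) Filter.univ_mem
    (Filter.Eventually.of_forall fun t =>
      ((continuous_colEval hm P).comp (continuous_const_mul _)).aestronglyMeasurable)
    (((continuous_colEval hm P).comp (continuous_const_mul _)).integrable_of_hasCompactSupport
      (HasCompactSupport.of_compactSpace _))
    ((continuous_colEval hm _).comp (continuous_const_mul _)).neg.aestronglyMeasurable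
    (Filter.Eventually.of_forall fun g t _ => by rw [norm_neg]; exact hK _ (Set.mem_univ _))
    (integrable_const K) (Filter.Eventually.of_forall fun g t _ => hderiv g t)).2
  simp only [integral_neg, integral_mul_left_eq_self (μ := haarSO m) (colEval hm _)] at hmain
  have := hmain.unique (hasDerivAt_const _ _)
  rw [stiefelIntegral_apply]
  exact neg_eq_zero.1 this

theorem stiefelIntegral_eq_pizzetti (hm : 4 < m) :
    stiefelIntegral hm = pizzetti (m := m) (by omega) := by
  rw [← sub_eq_zero]
  refine eq_zero_of_invariant (by omega) (fun P => ?_) (fun P => ?_) (fun P => ?_)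
    (fun a b P => ?_) ?_
  · simp only [LinearMap.sub_apply, pizzetti_normSqX_mul, stiefelIntegral_apply, colEval_mul,
      colEval_normSqX, one_mul]
  · simp only [LinearMap.sub_apply, pizzetti_normSqU_mul, stiefelIntegral_apply, colEval_mul,
      colEval_normSqU, one_mul]
  · simp only [LinearMap.sub_apply, pizzetti_innerXU_mul, stiefelIntegral_apply, colEval_mul,
      colEval_innerXU, zero_mul, integral_zero, sub_zero]
  · rw [LinearMap.sub_apply, pizzetti_opRot, stiefelIntegral_opRot, sub_zero]
  · have h1 : ∀ g, colEval hm 1 g = 1 := fun g => map_one _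
    simp [LinearMap.sub_apply, pizzetti_one, stiefelIntegral_apply, h1]

end StiefelPizzetti

end

/-! ### The Pizzetti formula -/

theorem mainTheorem6 (m : ℕ) (hm : 4 < m) (P : StiefelPizzetti.Poly m) :
    MeasureTheory.Integrable
        (fun p : StiefelPizzetti.stiefel m => StiefelPizzetti.evalAt P p.1.1 p.1.2)
        (StiefelPizzetti.stiefelMeasure hm) ∧
      (Function.support fun n : ℕ × ℕ × ℕ =>
        StiefelPizzetti.gammaCoeff m n.1 *
          StiefelPizzetti.evalAt ((StiefelPizzetti.opA ^ (2 * n.1))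
            (StiefelPizzetti.projJK n.2.1 n.2.2 P)) 0 0).Finite ∧
      ∫ p : StiefelPizzetti.stiefel m, StiefelPizzetti.evalAt P p.1.1 p.1.2
          ∂(StiefelPizzetti.stiefelMeasure hm) =
        ∑ᶠ n : ℕ × ℕ × ℕ,
          StiefelPizzetti.gammaCoeff m n.1 *
            StiefelPizzetti.evalAt ((StiefelPizzetti.opA ^ (2 * n.1))
              (StiefelPizzetti.projJK n.2.1 n.2.2 P)) 0 0 := by
  have hm2 : 2 < m := by omega
  simp only [StiefelPizzetti.evalAt_zero, ← StiefelPizzetti.pizzettiTerm_apply]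
  refine ⟨StiefelPizzetti.integrable_evalAt hm P,
    StiefelPizzetti.support_pizzettiTerm_finite hm2 P, ?_⟩
  rw [StiefelPizzetti.integral_evalAt, ← StiefelPizzetti.stiefelIntegral_apply,
    StiefelPizzetti.stiefelIntegral_eq_pizzetti, StiefelPizzetti.pizzetti_apply]
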